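/- **Setting.** Let $O_1,O_2,\dots$ be i.i.d. with law $P_0$ on a measurable space $\mathcal O$, $P_n$ the empirical distribution of $O_1,\dots,O_n$, and $X:\mathcal O\to[0,1]^d$ measurable; a function $f$ on the cube is regarded as the function $o\mapsto f(X(o))$ in $\|f\|_{P_0}=(P_0f^2)^{1/2}$ and $\|f\|_{1,P_0}=P_0|f|$. Let $L(\psi)(o)$ be a loss and $\psi_0$ a minimizer of $P_0L(\psi)$ over $D^{(0)}([0,1]^d)$, the càdlàg functions with finite sectional variation norm; $d_0(\theta,\psi_0)=P_0L(\theta)-P_0L(\psi_0)$. Let $S_\theta(f)=\frac{d}{d\delta}L(\theta+\delta f)\big|_{\delta=0}$ be the score. A $k$-th order spline basis function is a product over the coordinates of factors $x^m/m!$ ($0\le m\le k$) or $I(x\ge u)(x-u)^k/k!$ ($u\in[0,1]$). Assume that for $\theta,f$ in the linear span of these splines $S_\theta(f)$ exists, is linear in $f$ and measurable in $o$, and that for such $f$ the scores $S_{\psi_0}(f)$ exist and are $P_0$-integrable, $L(\psi_0+\delta f)$ is integrable for small $\delta$, and $\frac{d}{d\delta}P_0L(\psi_0+\delta f)|_{\delta=0}=P_0S_{\psi_0}(f)$.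 For each $n$ let (possibly depending on the data) $\phi_1,\dots,\phi_N$ be $k$-th order splines, $x_1,\dots,x_m\in[0,1]^d$, $H_{ij}=\phi_j(x_i)$, $\langle\cdot,\cdot\rangle_n$ an inner product on $\mathbb R^m$ with $H^\top$ the corresponding adjoint of $H$, and let $E_1,\dots,E_q$ be orthonormal eigenvectors of $H^\top H$ with non-zero eigenvalues (all of them, or some of them). Put $\tilde\phi_i=\sum_jE_i(j)\phi_j$, $\theta_{n,\alpha}=\sum_i\alpha(i)\tilde\phi_i$, $\beta(\alpha)(j)=\sum_i\alpha(i)E_i(j)$. Let $C_n>0$ (possibly data dependent), let $\alpha_n$ minimize $P_nL(\theta_{n,\alpha})$ over $\|\alpha\|_2\le C_n$ (the PC-HAR estimator), and $\theta_n=\theta_{n,\alpha_n}$. Let $\mathcal E(J_n)=\{m:\alpha_n(m)\ne0\}$, $J_n$ its cardinality, $D(\mathcal E(J_n))$ the functions $f=\sum_{m\in\mathcal E(J_n)}\alpha(f)(m)\tilde\phi_m$, with $\langle f,g\rangle=\sum_m\alpha(f)(m)\alpha(g)(m)$ and $\|f\|_2=\|\alpha(f)\|_2$, and $D_M(\mathcal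 E(J_n))$ those with $\|\beta(\alpha(f))\|_1\le M$. Let $$f_{\alpha_n}=\|\alpha_n\|_2^{-1}\sum_m\alpha_n(m)\tilde\phi_m,\qquad f^*_{\alpha_n}=J_n^{-1/2}f_{\alpha_n},\qquad D_n(\mathcal E(J_n))=\{f\in D(\mathcal E(J_n)):\langle f,f_{\alpha_n}\rangle=0\},$$ (all zero if $\alpha_n=0$), and let $\tilde f_{\alpha_n}$ be a minimizer of $P_0(f^*_{\alpha_n}-f)^2$ over $f\in D_n(\mathcal E(J_n))$. **Theorem.** 1. $\theta_n$ minimizes $P_nL$ over the elements of $D(\mathcal E(J_n))$ with $\|f\|_2\le C_n$, and $P_nS_{\theta_n}\big(\sum_mh(m)\tilde\phi_m\big)=0$ for all $h\perp\alpha_n$. 2. For every $f^*\in D(\mathcal E(J_n))$, $P_nS_{\theta_n}(f^*)=J_n^{1/2}\langle f^*,f_{\alpha_n}\rangle\,P_nS_{\theta_n}(f^*_{\alpha_n}-\tilde f_{\alpha_n})$; in particular $P_nS_{\theta_n}(f^*_{\alpha_n})=P_nS_{\theta_n}(f^*_{\alpha_n}-\tilde f_{\alpha_n})$. 3. For $m\in\mathcal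 E(J_n)$ let $c_n(m)=J_n^{-1/2}\|\alpha_n\|_2/|\alpha_n(m)|$, so that $\|\alpha_n\|_2^2/|\alpha_n(m)|=J_n^{1/2}\|\alpha_n\|_2\,c_n(m)$ (hence $c_n(m)\asymp\|\alpha_n\|_2^2/|\alpha_n(m)|$ if $\|\alpha_n\|_2\asymp J_n^{-1/2}$). Then $$\|f^*_{\alpha_n}-\tilde f_{\alpha_n}\|_{1,P_0}\le\|f^*_{\alpha_n}-\tilde f_{\alpha_n}\|_{P_0}\le\min_{m\in\mathcal E(J_n)}c_n(m)\|\tilde\phi_m\|_{P_0},\qquad \inf_{f\in D_n(\mathcal E(J_n))}\|f^*_{\alpha_n}-f\|_{1,P_0}\le\min_{m\in\mathcal E(J_n)}c_n(m)\|\tilde\phi_m\|_{1,P_0}.$$ 4. Let $M$ be such that the following hold. (a) Let $\mathcal F_n$ be the class of all $S_\theta(f)$ with $\theta,f\in D_M(\mathcal E(J_n))$, for all possible values of $\mathcal E(J_n)$ and of the basis. There are $K$ and $\gamma<2$, not depending on $n$, such that either $\log N(\epsilon,\mathcal F_n,\|\cdot\|_\infty)\le K\epsilon^{-\gamma}$ for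 $0<\epsilon\le1$, or $\mathcal F_n$ is contained in a pointwise measurable class $\mathcal F_n'$, bounded uniformly in $n$, with $\log N(\epsilon,\mathcal F_n',L^2(Q))\le K\epsilon^{-\gamma}$ for $0<\epsilon\le1$ and every uniform distribution $Q$ on finitely many points. (The order $\epsilon^{-1/(k+1)}$, up to logarithms, of the entropy of $D^{(k)}_M([0,1]^d)$ is of this kind.) (b) With probability tending to one, $\theta_n$ and $f^*_{\alpha_n}-\tilde f_{\alpha_n}$ are in $D_M(\mathcal E(J_n))$; and $\|S_{\theta_n}(f^*_{\alpha_n}-\tilde f_{\alpha_n})\|_{P_0}=o_P(1)$. (c) Either there is $K$ with $|P_0(S_\theta-S_{\psi_0})(f)|\le K\|\theta-\psi_0\|_\infty\|f\|_{1,P_0}$ for all $\theta,f\in D_M(\mathcal E(J_n))$ and $\|\theta_n-\psi_0\|_\infty\|f^*_{\alpha_n}-\tilde f_{\alpha_n}\|_{1,P_0}=o_P(n^{-1/2})$; or there is $K$ with $|P_0(S_\theta-S_{\psi_0})(f)|\le Kd_0^{1/2}(\theta,\psi_0)\|f\|_{P_0}$ for all such $\theta,f$ and $d_0^{1/2}(\theta_n,\psi_0)\|f^*_{\alpha_n}-\tilde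 f_{\alpha_n}\|_{P_0}=o_P(n^{-1/2})$. Then $$\sup_{f^*\in D_M(\mathcal E(J_n)),\ \|f^*\|_2\le J_n^{-1/2}}\big|P_nS_{\theta_n}(f^*)\big|=o_P(n^{-1/2}).$$ (Where measurability is in doubt, $o_P$ refers to outer probability.) -/

import Mathlib

open MeasureTheory ProbabilityTheory Filter Topology Matrix
open scoped ENNReal

/-! ## Functions on the unit cube -/

/-- The unit cube `[0,1]^d`. -/
abbrev Cube (d : ℕ) : Type := Fin d → unitInterval

/-- Multivariate càdlàg functions on the cube: limits exist from every one of the `2^d` quadrants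
at every point, and the function is continuous from the upper-right quadrant. (If a quadrant is
empty, the limit condition is void.) -/
def IsCadlag {d : ℕ} (f : Cube d → ℝ) : Prop :=
  ∀ x : Cube d,
    ContinuousWithinAt f (Set.Ici x) x ∧
    ∀ σ : Fin d → Bool, ∃ l : ℝ,
      Tendsto f (𝓝[{y | ∀ j, if σ j then y j < x j else x j ≤ y j}] x) (𝓝 l)

/-- The increment of the section `f_s : x(s) ↦ f(x(s), 0(-s))` over the box with lower corner `a`
and upper corner `b` (only the coordinates in `s` matter). For `s = ∅` this is `f 0`. -/
noncomputable def boxIncrement {d : ℕ} (s : Finset (Fin d)) (f : Cube d → ℝ) (a b : Cube d) : ℝ :=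
  ∑ r ∈ s.powerset, (-1 : ℝ) ^ (s \ r).card *
    f (fun j => if j ∈ r then b j else if j ∈ s then a j else 0)

/-- The (Vitali) variation norm `‖f_s‖_v = ∫ |df_s|` of the section `f_s`: the supremum over all
grids of the sum of the absolute increments. For `s = ∅` this is `|f 0|`. -/
noncomputable def sectionVariation {d : ℕ} (s : Finset (Fin d)) (f : Cube d → ℝ) : ℝ≥0∞ :=
  ⨆ (G : ℕ) (t : Fin d → ℕ → unitInterval) (_ : ∀ j, Monotone (t j)),
    ∑ i : (s → Fin G),
      ENNReal.ofReal |boxIncrement s f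
        (fun j => if h : j ∈ s then t j (i ⟨j, h⟩) else 0)
        (fun j => if h : j ∈ s then t j (i ⟨j, h⟩ + 1) else 0)|

/-- The sectional variation norm `‖f‖_v^* = |f(0)| + ∑_{s ≠ ∅} ‖f_s‖_v`. -/
noncomputable def sectionalVariationNorm {d : ℕ} (f : Cube d → ℝ) : ℝ≥0∞ :=
  ∑ s : Finset (Fin d), sectionVariation s f

/-- `D^{(0)}([0,1]^d)`: càdlàg functions with finite sectional variation norm. -/
def cadlagBV (d : ℕ) : Set (Cube d → ℝ) :=
  {f | IsCadlag f ∧ sectionalVariationNorm f ≠ ⊤}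

/-! ## Splines of order `k` -/

/-- One coordinate of a `k`-th order tensor product spline: either a power `x^m / m!` with
`0 ≤ m ≤ k` or a truncated power with a knot in `[0,1]`. A nested family
`s_k ⊆ ⋯ ⊆ s_0 ⊆ {1,…,d}` of active coordinates is the same as a choice, coordinate by coordinate,
of the level `m` at which the coordinate drops out (`j ∉ s_0` is `m = 0`), or of survival. -/
abbrev SplineFactor (k : ℕ) : Type := Fin (k + 1) ⊕ unitInterval

/-- `x^m / m!`, respectively `I(x ≥ u) (x - u)^k / k!`. -/
noncomputable def SplineFactor.eval {k : ℕ} (b : SplineFactor k) (x : unitInterval) : ℝ :=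
  match b with
  | Sum.inl m => (x : ℝ) ^ (m : ℕ) / (Nat.factorial (m : ℕ) : ℝ)
  | Sum.inr u => if u ≤ x then ((x : ℝ) - (u : ℝ)) ^ k / (Nat.factorial k : ℝ) else 0

/-- The `k`-th order spline basis function on the cube with the given coordinate factors. -/
noncomputable def spline {d k : ℕ} (b : Fin d → SplineFactor k) (x : Cube d) : ℝ :=
  ∏ j, (b j).eval (x j)

/-- The linear span of all `k`-th order spline basis functions. -/
noncomputable def splineSpace (d k : ℕ) : Submodule ℝ (Cube d → ℝ) :=
  Submodule.span ℝ (Set.range (spline (d := d) (k := k)))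

/-- The design matrix `H(i,j) = φ_j(x_i)`. -/
noncomputable def designMatrix {d k N m : ℕ} (b : Fin N → Fin d → SplineFactor k)
    (x : Fin m → Cube d) : Matrix (Fin m) (Fin N) ℝ :=
  Matrix.of fun i j => spline (b j) (x i)

/-! ## The principal component working model -/

/-- The data of a principal component working model: `N` spline basis functions `φ_j`, design
points `x_i`, an inner product `⟨u,v⟩ = uᵀ W v` on the image space of the design matrix `H`
(the standard choice is `W = (1/m) 1`), so that `Hᵀ W` is the adjoint of `H`, and `q` orthonormal
eigenvectors (the columns of `E`) of `Hᵀ W H` with non-zero eigenvalues. All eigenvectors with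
non-zero eigenvalue may be used, or only some of them (screening). -/
structure PCModel (d k : ℕ) where
  N : ℕ
  basis : Fin N → Fin d → SplineFactor k
  m : ℕ
  x : Fin m → Cube d
  W : Matrix (Fin m) (Fin m) ℝ
  W_posDef : W.PosDef
  q : ℕ
  E : Matrix (Fin N) (Fin q) ℝ
  eigenvalue : Fin q → ℝ
  eigenvalue_ne_zero : ∀ i, eigenvalue i ≠ 0
  E_orthonormal : Eᵀ * E = 1
  E_eigen : (designMatrix basis x)ᵀ * W * designMatrix basis x * E
    = E * Matrix.diagonal eigenvalue

namespace PCModel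

variable {d k : ℕ} (B : PCModel d k)

/-- The PC basis function `φ̃_m = ∑_j E(j,m) φ_j`. -/
noncomputable def pc (i : Fin B.q) (x : Cube d) : ℝ := ∑ j, B.E j i * spline (B.basis j) x

/-- `θ_a = ∑_m a(m) φ̃_m`. -/
noncomputable def theta (a : Fin B.q → ℝ) (x : Cube d) : ℝ := ∑ i, a i * B.pc i x

/-- The coefficients `β(a)` of `θ_a` in the original spline basis. -/
def beta (a : Fin B.q → ℝ) (j : Fin B.N) : ℝ := ∑ i, a i * B.E j i

end PCModel

/-! ## Coefficient vectors -/

section Coefficients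

variable {q : ℕ}

/-- The standard inner product of coefficient vectors. -/
def ip (a b : Fin q → ℝ) : ℝ := ∑ i, a i * b i

/-- The Euclidean norm of a coefficient vector. -/
noncomputable def norm2 (a : Fin q → ℝ) : ℝ := Real.sqrt (∑ i, a i ^ 2)

/-- `J`: the number of non-zero coefficients. -/
noncomputable def activeCard (a : Fin q → ℝ) : ℕ := (Finset.univ.filter fun i => a i ≠ 0).card

/-- `f` is in `D(𝓔(J))`: its coefficients vanish outside the active set `𝓔(J) = {m : a(m) ≠ 0}`. -/
def ActiveIn (a f : Fin q → ℝ) : Prop := ∀ i, a i = 0 → f i = 0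

/-- Coefficients of `f_a = ‖a‖₂⁻¹ ∑_m a(m) φ̃_m`. -/
noncomputable def unitDir (a : Fin q → ℝ) : Fin q → ℝ := fun i => a i / norm2 a

/-- Coefficients of `f_a^* = J^{-1/2} f_a`. -/
noncomputable def starDir (a : Fin q → ℝ) : Fin q → ℝ :=
  fun i => unitDir a i / Real.sqrt (activeCard a)

/-- Coefficients of the elements of `D_n(𝓔(J)) = {f ∈ D(𝓔(J)) : f ⊥ f_a}`. -/
def tangentDirs (a : Fin q → ℝ) : Set (Fin q → ℝ) :=
  {h | ActiveIn a h ∧ ip h (unitDir a) = 0}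

/-- The constant `c(m) = J^{-1/2} ‖a‖₂ / |a(m)|`. -/
noncomputable def cConst (a : Fin q → ℝ) (i : Fin q) : ℝ :=
  norm2 a / (Real.sqrt (activeCard a) * |a i|)

end Coefficients

/-- Coefficients of the elements of `D_M(𝓔(J))`, `𝓔(J) = {m : a(m) ≠ 0}`: those elements of
`D(𝓔(J))` whose coefficients in the spline basis have `L_1`-norm at most `M`. -/
def PCModel.ballM {d k : ℕ} (B : PCModel d k) (M : ℝ) (a : Fin B.q → ℝ) : Set (Fin B.q → ℝ) :=
  {f | ActiveIn a f ∧ ∑ j, |B.beta f j| ≤ M}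

/-! ## Loss, score, empirical risk -/

section Statistics

variable {𝒪 Ω : Type*} {d : ℕ}

/-- The score `d/dθ L(θ)(f)(o) = d/dδ L(θ + δ f)(o)` at `δ = 0`. -/
noncomputable def score (L : (Cube d → ℝ) → 𝒪 → ℝ) (θ f : Cube d → ℝ) (o : 𝒪) : ℝ :=
  deriv (fun δ : ℝ => L (θ + δ • f) o) 0

/-- `P_n g = (1/n) ∑_{i ≤ n} g(O_i)`. -/
noncomputable def empMean (O : ℕ → Ω → 𝒪) (n : ℕ) (ω : Ω) (g : 𝒪 → ℝ) : ℝ :=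
  (n : ℝ)⁻¹ * ∑ i ∈ Finset.range n, g (O i ω)

/-- `X_n = o_P(r_n)`, for `[0,∞]`-valued `X_n` (outer probability if `X_n` is not measurable). -/
def IsLittleOP [MeasurableSpace Ω] (μ : Measure Ω) (X : ℕ → Ω → ℝ≥0∞) (r : ℕ → ℝ) : Prop :=
  ∀ ε : ℝ, 0 < ε → Tendsto (fun n => μ {ω | ENNReal.ofReal (ε * r n) < X n ω}) atTop (𝓝 0)

/-- `‖f - g‖_∞`. -/
noncomputable def supDist {T : Type*} (f g : T → ℝ) : ℝ≥0∞ := ⨆ x, ENNReal.ofReal |f x - g x|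

/-- `a` is the coefficient vector of the PC-HAR estimator with radius `C`: it minimises the
empirical risk over the Euclidean ball of radius `C`. -/
def IsPCHAR {k : ℕ} (L : (Cube d → ℝ) → 𝒪 → ℝ) (O : ℕ → Ω → 𝒪) (n : ℕ) (ω : Ω)
    (B : PCModel d k) (C : ℝ) (a : Fin B.q → ℝ) : Prop :=
  norm2 a ≤ C ∧ ∀ b : Fin B.q → ℝ, norm2 b ≤ C →
    empMean O n ω (L (B.theta a)) ≤ empMean O n ω (L (B.theta b))

/-- `t` is the coefficient vector of an `L²(P₀)`-projection of `f_a^*` onto `D_n(𝓔(J))`. A function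
`f` on the cube is regarded as the function `o ↦ f (X o)` of the observation. -/
def IsL2Projection [MeasurableSpace 𝒪] {k : ℕ} (P₀ : Measure 𝒪) (X : 𝒪 → Cube d)
    (B : PCModel d k) (a t : Fin B.q → ℝ) : Prop :=
  t ∈ tangentDirs a ∧ ∀ h ∈ tangentDirs a,
    ∫ o, (B.theta (starDir a) (X o) - B.theta t (X o)) ^ 2 ∂P₀
      ≤ ∫ o, (B.theta (starDir a) (X o) - B.theta h (X o)) ^ 2 ∂P₀

/-- `ψ₀` minimises the risk `P₀ L(ψ)` over `D^{(0)}([0,1]^d)`. -/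
def IsRiskMinimizer [MeasurableSpace 𝒪] (P₀ : Measure 𝒪) (L : (Cube d → ℝ) → 𝒪 → ℝ)
    (ψ₀ : Cube d → ℝ) : Prop :=
  ψ₀ ∈ cadlagBV d ∧ Integrable (L ψ₀) P₀ ∧
    ∀ ψ ∈ cadlagBV d, Integrable (L ψ) P₀ → ∫ o, L ψ₀ o ∂P₀ ≤ ∫ o, L ψ o ∂P₀

/-- The loss has directional derivatives, linear in the direction and measurable in the
observation, on the space `V` of functions. -/
structure HasLinearScore [MeasurableSpace 𝒪] (L : (Cube d → ℝ) → 𝒪 → ℝ)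
    (V : Submodule ℝ (Cube d → ℝ)) : Prop where
  differentiable : ∀ θ ∈ V, ∀ f ∈ V, ∀ o, DifferentiableAt ℝ (fun δ : ℝ => L (θ + δ • f) o) 0
  add : ∀ θ ∈ V, ∀ f ∈ V, ∀ g ∈ V, ∀ o, score L θ (f + g) o = score L θ f o + score L θ g o
  measurable : ∀ θ ∈ V, ∀ f ∈ V, Measurable (score L θ f)

/-- At `ψ₀` the loss has directional derivatives in the directions `f ∈ V`, and the risk may be
differentiated under the integral sign in these directions. -/
structure HasScoreAt [MeasurableSpace 𝒪] (P₀ : Measure 𝒪) (L : (Cube d → ℝ) → 𝒪 → ℝ)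
    (ψ₀ : Cube d → ℝ) (V : Submodule ℝ (Cube d → ℝ)) : Prop where
  differentiable : ∀ f ∈ V, ∀ o, DifferentiableAt ℝ (fun δ : ℝ => L (ψ₀ + δ • f) o) 0
  integrable_loss : ∀ f ∈ V, ∀ᶠ δ : ℝ in 𝓝 0, Integrable (L (ψ₀ + δ • f)) P₀
  integrable_score : ∀ f ∈ V, Integrable (score L ψ₀ f) P₀
  hasDerivAt : ∀ f ∈ V,
    HasDerivAt (fun δ : ℝ => ∫ o, L (ψ₀ + δ • f) o ∂P₀) (∫ o, score L ψ₀ f o ∂P₀) 0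

/-- The class of scores `d/dθ L(θ)(f)`, `θ, f ∈ D_M(𝓔(J_n))`. The active set `𝓔(J_n)` is random;
the class collects its possible values at sample size `n`. -/
def scoreClass {k : ℕ} (L : (Cube d → ℝ) → 𝒪 → ℝ) (M : ℝ) (B : ℕ → Ω → PCModel d k)
    (α : ∀ n ω, Fin (B n ω).q → ℝ) (n : ℕ) : Set (𝒪 → ℝ) :=
  {g | ∃ ω, ∃ θ ∈ (B n ω).ballM M (α n ω), ∃ f ∈ (B n ω).ballM M (α n ω),
    g = score L ((B n ω).theta θ) ((B n ω).theta f)}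

end Statistics

/-! ## Covering numbers and entropy -/

section Entropy

variable {𝒪 : Type*}

/-- The covering number `N(ε, F, ρ)`: the least number of `ρ`-balls of radius `ε` covering `F`. -/
noncomputable def coverNumber (ρ : (𝒪 → ℝ) → (𝒪 → ℝ) → ℝ≥0∞) (ε : ℝ) (F : Set (𝒪 → ℝ)) : ℕ∞ :=
  ⨅ (T : Finset (𝒪 → ℝ)) (_ : ∀ f ∈ F, ∃ g ∈ T, ρ f g ≤ ENNReal.ofReal ε), (T.card : ℕ∞)

/-- `log N(ε, F, ρ) ≤ K ε^{-γ}` for all `0 < ε ≤ 1`. -/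
def EntropyBound (ρ : (𝒪 → ℝ) → (𝒪 → ℝ) → ℝ≥0∞) (K γ : ℝ) (F : Set (𝒪 → ℝ)) : Prop :=
  ∀ ε : ℝ, 0 < ε → ε ≤ 1 →
    coverNumber ρ ε F ≠ ⊤ ∧ Real.log ((coverNumber ρ ε F).toNat : ℝ) ≤ K * ε ^ (-γ)

/-- The `L²(Q)`-distance for the uniform distribution `Q` on the points `z_1,…,z_m`. -/
noncomputable def l2Dist {m : ℕ} (z : Fin m → 𝒪) (f g : 𝒪 → ℝ) : ℝ≥0∞ :=
  ENNReal.ofReal (Real.sqrt ((m : ℝ)⁻¹ * ∑ i, (f (z i) - g (z i)) ^ 2))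

/-- A pointwise measurable class: measurable functions, each of which is the pointwise limit of a
sequence from a fixed countable subclass. -/
def PointwiseMeasurable [MeasurableSpace 𝒪] (F : Set (𝒪 → ℝ)) : Prop :=
  (∀ f ∈ F, Measurable f) ∧ ∃ G : Set (𝒪 → ℝ), G ⊆ F ∧ G.Countable ∧
    ∀ f ∈ F, ∃ g : ℕ → 𝒪 → ℝ, (∀ j, g j ∈ G) ∧ ∀ o, Tendsto (fun j => g j o) atTop (𝓝 (f o))

/-- The entropy condition on a sequence of classes: with constants `K` and `γ < 2` not depending on
the sample size, either the supremum norm entropy is at most `K ε^{-γ}`, or the classes are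
contained in uniformly bounded, pointwise measurable classes whose entropy in `L²(Q)` is at most
`K ε^{-γ}` uniformly in the finitely supported `Q`. (The entropy of `D_M^{(k)}([0,1]^d)` has order
`ε^{-1/(k+1)}` up to logarithms, in supremum norm for `k ≥ 1` and in `L²` for `k = 0`.) -/
def EntropyCondition [MeasurableSpace 𝒪] (F : ℕ → Set (𝒪 → ℝ)) : Prop :=
  ∃ K γ : ℝ, 0 < γ ∧ γ < 2 ∧
    ((∀ n, EntropyBound supDist K γ (F n)) ∨
      ∃ (b : ℝ) (F' : ℕ → Set (𝒪 → ℝ)), ∀ n, F n ⊆ F' n ∧ PointwiseMeasurable (F' n) ∧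
        (∀ f ∈ F' n, ∀ o, |f o| ≤ b) ∧
        ∀ (m : ℕ), 0 < m → ∀ z : Fin m → 𝒪, EntropyBound (l2Dist z) K γ (F' n))

end Entropy

/-! ## Splines are càdlàg functions of finite sectional variation -/

namespace SplineFactor

variable {k : ℕ}

/-! The proof has a deterministic half and a probabilistic half.

Deterministic half. The estimator minimizes a directionally differentiable function over a Euclidean
ball, so the empirical score is nonnegative in every direction that points into the ball. A
direction `h` orthogonal to `a` is a limit of inward directions `h - ε a`. Linearity of the score,
applied to `h` and `-h`, gives score zero on the whole hyperplane orthogonal to `a`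
(`IsPCHAR.empMean_score_eq_zero`). Hence the score is determined by its value in the single
direction `a`, and subtracting any tangent `t` from that direction changes nothing. By
Cauchy-Schwarz, the supremum over the ball of radius `J^{-1/2}` is at most the score at `f_a^* - t`.
If a multiple of one coordinate vector is subtracted from `f_a^*` so that the rest is orthogonal to
`a`, the residual is that multiple of a single basis function. This bounds the projection error.

Probabilistic half. Splines have finite sectional variation, so the lines `ψ₀ + δ f` stay in the
class over which `ψ₀` minimizes the risk, and `P₀ S_{ψ₀}(f) = 0`. Therefore `P_n S_θ(f) = (P_n - P₀)
S_θ(f) + P₀ (S_θ - S_{ψ₀})(f)`. The last term is the assumed second order remainder. The first is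
`o_P(n^{-1/2})` by asymptotic equicontinuity (`EntropyCondition.equicontinuity`): the bound is
uniform over all functions of small second moment in the score class, so the data dependence of `θ`
and `f` does no harm.

Equicontinuity rests on a maximal inequality for finite classes
(`exists_lintegral_sup_centered_le`): symmetrization passes to Rademacher sums, and dyadic chaining
bounds these by a power `1 - γ/2 > 0` of the empirical `L²` radius. The radius is random; its mean
is controlled by symmetrizing and chaining the squares. Finite classes are then exchanged for the
full ones by a countable dense subclass, or by nets in supremum norm. -/

theorem eval_monotone (b : SplineFactor k) : Monotone b.eval := by
  intro x y hxy
  have hxy' : (x : ℝ) ≤ y := hxy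
  rcases b with m | u
  · simp only [SplineFactor.eval]
    have := x.2.1
    gcongr
  · simp only [SplineFactor.eval]
    by_cases hx : u ≤ x
    · have hx' : (u : ℝ) ≤ x := hx
      rw [if_pos hx, if_pos (hx.trans hxy)]
      gcongr
    · rw [if_neg hx]
      split_ifs with hy
      · have hy' : (u : ℝ) ≤ y := hy
        have : (0 : ℝ) ≤ y - u := by linarith
        positivity
      · exact le_rfl

theorem eval_nonneg (b : SplineFactor k) (x : unitInterval) : 0 ≤ b.eval x := by
  have hx0 := x.2.1
  rcases b with m | u
  · simp only [SplineFactor.eval]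
    positivity
  · simp only [SplineFactor.eval]
    split_ifs with hx
    · have hx' : (u : ℝ) ≤ x := hx
      have : (0 : ℝ) ≤ x - u := by linarith
      positivity
    · exact le_rfl

theorem eval_le_one (b : SplineFactor k) (x : unitInterval) : b.eval x ≤ 1 := by
  have hx0 := x.2.1
  have hx1 := x.2.2
  have hfac : ∀ m : ℕ, (1 : ℝ) ≤ (Nat.factorial m : ℝ) := fun m => by
    exact_mod_cast Nat.one_le_iff_ne_zero.2 (Nat.factorial_ne_zero m)
  rcases b with m | u
  · simp only [SplineFactor.eval]
    exact div_le_one_of_le₀ ((pow_le_one₀ hx0 hx1).trans (hfac _)) (by positivity)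
  · simp only [SplineFactor.eval]
    split_ifs with hx
    · have hx' : (u : ℝ) ≤ x := hx
      have hu := u.2.1
      exact div_le_one_of_le₀ ((pow_le_one₀ (by linarith) (by linarith)).trans (hfac _))
        (by positivity)
    · exact zero_le_one

theorem continuousWithinAt_eval (b : SplineFactor k) (x : unitInterval) :
    ContinuousWithinAt b.eval (Set.Ici x) x := by
  rcases b with m | u
  · have hc : Continuous fun y : unitInterval => (y : ℝ) ^ (m : ℕ) / (Nat.factorial (m : ℕ) : ℝ) := by
      fun_prop
    exact hc.continuousWithinAt
  · by_cases hx : u ≤ x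
    · have hc : ContinuousWithinAt
          (fun y : unitInterval => ((y : ℝ) - (u : ℝ)) ^ k / (Nat.factorial k : ℝ)) (Set.Ici x) x :=
        Continuous.continuousWithinAt (by fun_prop)
      refine hc.congr (fun y hy => ?_) ?_
      · simp only [SplineFactor.eval]
        rw [if_pos (hx.trans hy)]
      · simp only [SplineFactor.eval]
        rw [if_pos hx]
    · refine ContinuousAt.continuousWithinAt ?_
      have h0 : (fun _ : unitInterval => (0 : ℝ)) =ᶠ[𝓝 x] SplineFactor.eval (k := k) (Sum.inr u) := by
        filter_upwards [Iio_mem_nhds (not_le.1 hx)] with y hy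
        simp only [SplineFactor.eval]
        rw [if_neg (not_le.2 hy)]
      exact continuousAt_const.congr h0

theorem exists_tendsto_left (b : SplineFactor k) (x : unitInterval) :
    ∃ l, Tendsto b.eval (𝓝[<] x) (𝓝 l) :=
  ⟨_, b.eval_monotone.tendsto_nhdsLT x⟩

end SplineFactor

theorem isCadlag_spline {d k : ℕ} (b : Fin d → SplineFactor k) : IsCadlag (spline b) := by
  intro x
  constructor
  · refine tendsto_finsetProd _ fun j _ => ?_
    refine ((b j).continuousWithinAt_eval (x j)).tendsto.comp ?_
    refine tendsto_nhdsWithin_iff.2 ⟨?_, ?_⟩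
    · exact ((continuous_apply j).tendsto x).mono_left nhdsWithin_le_nhds
    · exact eventually_nhdsWithin_of_forall fun y hy => hy j
  · intro σ
    have key : ∀ j, ∃ l, Tendsto (fun y : Cube d => (b j).eval (y j))
        (𝓝[{y | ∀ j, if σ j then y j < x j else x j ≤ y j}] x) (𝓝 l) := by
      intro j
      have hj : Tendsto (fun y : Cube d => y j)
          (𝓝[{y | ∀ j, if σ j then y j < x j else x j ≤ y j}] x) (𝓝 (x j)) :=
        ((continuous_apply j).tendsto x).mono_left nhdsWithin_le_nhds
      -- A quadrant is a product of half-lines, so each factor needs only its right-continuity or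
      -- its left limit.
      cases hσ : σ j
      · refine ⟨_, ((b j).continuousWithinAt_eval (x j)).tendsto.comp
          (tendsto_nhdsWithin_iff.2 ⟨hj, ?_⟩)⟩
        refine eventually_nhdsWithin_of_forall fun y hy => ?_
        simpa [hσ] using hy j
      · obtain ⟨l, hl⟩ := (b j).exists_tendsto_left (x j)
        refine ⟨l, hl.comp (tendsto_nhdsWithin_iff.2 ⟨hj, ?_⟩)⟩
        refine eventually_nhdsWithin_of_forall fun y hy => ?_
        simpa [hσ] using hy j
    choose l hl using key
    exact ⟨∏ j, l j, tendsto_finsetProd _ fun j _ => hl j⟩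

theorem IsCadlag.add {d : ℕ} {f g : Cube d → ℝ} (hf : IsCadlag f) (hg : IsCadlag g) :
    IsCadlag (f + g) := fun x =>
  ⟨(hf x).1.add (hg x).1, fun σ => by
    obtain ⟨l, hl⟩ := (hf x).2 σ
    obtain ⟨l', hl'⟩ := (hg x).2 σ
    exact ⟨l + l', hl.add hl'⟩⟩

theorem IsCadlag.smul {d : ℕ} {f : Cube d → ℝ} (hf : IsCadlag f) (c : ℝ) :
    IsCadlag (c • f) := fun x =>
  ⟨(hf x).1.const_smul c, fun σ => by
    obtain ⟨l, hl⟩ := (hf x).2 σ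
    exact ⟨c • l, hl.const_smul c⟩⟩

theorem boxIncrement_add {d : ℕ} (s : Finset (Fin d)) (f g : Cube d → ℝ) (a b : Cube d) :
    boxIncrement s (f + g) a b = boxIncrement s f a b + boxIncrement s g a b := by
  simp [boxIncrement, mul_add, Finset.sum_add_distrib]

theorem boxIncrement_smul {d : ℕ} (s : Finset (Fin d)) (c : ℝ) (f : Cube d → ℝ) (a b : Cube d) :
    boxIncrement s (c • f) a b = c * boxIncrement s f a b := by
  simp only [boxIncrement, Pi.smul_apply, smul_eq_mul, Finset.mul_sum]
  exact Finset.sum_congr rfl fun _ _ => by ring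

theorem sectionVariation_add_le {d : ℕ} (s : Finset (Fin d)) (f g : Cube d → ℝ) :
    sectionVariation s (f + g) ≤ sectionVariation s f + sectionVariation s g := by
  refine iSup_le fun G => iSup_le fun t => iSup_le fun ht => ?_
  refine le_trans ?_ (add_le_add
    (le_iSup_of_le G (le_iSup_of_le t (le_iSup_of_le ht le_rfl)))
    (le_iSup_of_le G (le_iSup_of_le t (le_iSup_of_le ht le_rfl))))
  rw [← Finset.sum_add_distrib]
  refine Finset.sum_le_sum fun i _ => ?_
  rw [boxIncrement_add]
  exact (ENNReal.ofReal_le_ofReal (abs_add_le _ _)).trans ENNReal.ofReal_add_le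

theorem sectionVariation_smul_le {d : ℕ} (s : Finset (Fin d)) (c : ℝ) (f : Cube d → ℝ) :
    sectionVariation s (c • f) ≤ ENNReal.ofReal |c| * sectionVariation s f := by
  refine iSup_le fun G => iSup_le fun t => iSup_le fun ht => ?_
  refine le_trans ?_ (mul_le_mul' le_rfl
    (le_iSup_of_le G (le_iSup_of_le t (le_iSup_of_le ht le_rfl))))
  rw [Finset.mul_sum]
  refine Finset.sum_le_sum fun i _ => ?_
  rw [boxIncrement_smul, abs_mul, ENNReal.ofReal_mul (abs_nonneg _)]

theorem add_mem_cadlagBV {d : ℕ} {f g : Cube d → ℝ} (hf : f ∈ cadlagBV d) (hg : g ∈ cadlagBV d) :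
    f + g ∈ cadlagBV d := by
  refine ⟨hf.1.add hg.1, ne_top_of_le_ne_top (ENNReal.add_ne_top.2 ⟨hf.2, hg.2⟩) ?_⟩
  unfold sectionalVariationNorm
  rw [← Finset.sum_add_distrib]
  exact Finset.sum_le_sum fun s _ => sectionVariation_add_le s f g

theorem smul_mem_cadlagBV {d : ℕ} (c : ℝ) {f : Cube d → ℝ} (hf : f ∈ cadlagBV d) :
    c • f ∈ cadlagBV d := by
  refine ⟨hf.1.smul c, ne_top_of_le_ne_top 
    (ENNReal.mul_ne_top (ENNReal.ofReal_ne_top (r := |c|)) hf.2) ?_⟩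
  unfold sectionalVariationNorm
  rw [Finset.mul_sum]
  exact Finset.sum_le_sum fun s _ => sectionVariation_smul_le s c f

/-- Inclusion-exclusion over the corners of a box is the expansion of a product of differences, so
the increment of a tensor product factorizes. Inactive coordinates are frozen at 0. -/
theorem boxIncrement_spline {d k : ℕ} (s : Finset (Fin d)) (b : Fin d → SplineFactor k)
    (x y : Cube d) :
    boxIncrement s (spline b) x y =
      (∏ j ∈ s, ((b j).eval (y j) - (b j).eval (x j))) * ∏ j ∈ sᶜ, (b j).eval 0 := by
  have h : ∏ j ∈ s, ((b j).eval (y j) - (b j).eval (x j)) =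
      ∏ j ∈ s, ((b j).eval (y j) + -(b j).eval (x j)) := rfl
  rw [h, Finset.prod_add, Finset.sum_mul]
  refine Finset.sum_congr rfl fun r hr => ?_
  rw [Finset.mem_powerset] at hr
  rw [Finset.prod_neg, spline, ← Finset.prod_mul_prod_compl s, ← Finset.prod_sdiff hr]
  have h1 : ∏ j ∈ r, (b j).eval (if j ∈ r then y j else if j ∈ s then x j else 0)
      = ∏ j ∈ r, (b j).eval (y j) := Finset.prod_congr rfl fun j hj => by rw [if_pos hj]
  have h2 : ∏ j ∈ s \ r, (b j).eval (if j ∈ r then y j else if j ∈ s then x j else 0)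
      = ∏ j ∈ s \ r, (b j).eval (x j) := Finset.prod_congr rfl fun j hj => by
    rw [if_neg (Finset.mem_sdiff.1 hj).2, if_pos (Finset.mem_sdiff.1 hj).1]
  have h3 : ∏ j ∈ sᶜ, (b j).eval (if j ∈ r then y j else if j ∈ s then x j else 0)
      = ∏ j ∈ sᶜ, (b j).eval 0 := Finset.prod_congr rfl fun j hj => by
    rw [if_neg fun hjr => (Finset.mem_compl.1 hj) (hr hjr), if_neg (Finset.mem_compl.1 hj)]
  rw [h1, h2, h3]
  ring

/-- Monotone factors make all increments nonnegative. The sum over the grid is then a product of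
one-dimensional telescoping sums, each at most 1. -/
theorem sectionVariation_spline_le {d k : ℕ} (s : Finset (Fin d)) (b : Fin d → SplineFactor k) :
    sectionVariation s (spline b) ≤ 1 := by
  refine iSup_le fun G => iSup_le fun t => iSup_le fun ht => ?_
  set e : (j : s) → Fin G → ℝ := fun j g =>
    (b j).eval (t j ((g : ℕ) + 1)) - (b j).eval (t j (g : ℕ)) with he
  have he0 : ∀ j g, 0 ≤ e j g := fun j g => sub_nonneg.2 ((b j).eval_monotone (ht j (Nat.le_succ _)))
  have hle : ∀ i : s → Fin G, ENNReal.ofReal |boxIncrement s (spline b)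
        (fun j => if h : j ∈ s then t j (i ⟨j, h⟩) else 0)
        (fun j => if h : j ∈ s then t j (i ⟨j, h⟩ + 1) else 0)| ≤
      ENNReal.ofReal (∏ j : s, e j (i j)) := by
    intro i
    refine ENNReal.ofReal_le_ofReal ?_
    rw [boxIncrement_spline, ← Finset.prod_coe_sort s]
    have : ∀ j : s, (b j).eval (if h : (j : Fin d) ∈ s then t j (i ⟨j, h⟩ + 1) else 0) -
        (b j).eval (if h : (j : Fin d) ∈ s then t j (i ⟨j, h⟩) else 0) = e j (i j) := by
      intro j
      rw [dif_pos j.2, dif_pos j.2]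
    rw [Finset.prod_congr rfl fun j _ => this j, abs_of_nonneg (mul_nonneg
      (Finset.prod_nonneg fun j _ => he0 _ _) (Finset.prod_nonneg fun j _ => (b j).eval_nonneg 0))]
    exact mul_le_of_le_one_right (Finset.prod_nonneg fun j _ => he0 _ _)
      (Finset.prod_le_one (fun j _ => (b j).eval_nonneg 0) fun j _ => (b j).eval_le_one 0)
  refine (Finset.sum_le_sum fun i _ => hle i).trans ?_
  rw [← ENNReal.ofReal_sum_of_nonneg fun i _ => Finset.prod_nonneg fun j _ => he0 _ _,
    ← ENNReal.ofReal_one]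
  refine ENNReal.ofReal_le_ofReal ?_
  rw [← Fintype.prod_sum e]
  refine Finset.prod_le_one (fun j _ => Finset.sum_nonneg fun g _ => he0 j g) fun j _ => ?_
  rw [he, Fin.sum_univ_eq_sum_range
    (fun g => (b j).eval (t j (g + 1)) - (b j).eval (t j g)) G,
    Finset.sum_range_sub (fun g => (b j).eval (t j g))]
  linarith [(b j).eval_le_one (t j G), (b j).eval_nonneg (t j 0)]

theorem splineSpace_subset_cadlagBV {d k : ℕ} {f : Cube d → ℝ} (hf : f ∈ splineSpace d k) :
    f ∈ cadlagBV d := by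
  have hspline : ∀ b : Fin d → SplineFactor k, spline b ∈ cadlagBV d := fun b =>
    ⟨isCadlag_spline b, ne_top_of_le_ne_top (ENNReal.sum_ne_top.2 fun _ _ => ENNReal.one_ne_top)
      (Finset.sum_le_sum fun s _ => sectionVariation_spline_le s b)⟩
  induction hf using Submodule.span_induction with
  | mem x hx => obtain ⟨b, rfl⟩ := hx; exact hspline b
  | zero =>
    have := smul_mem_cadlagBV 0 (hspline (fun _ => Sum.inr 0))
    rwa [zero_smul] at this
  | add x y _ _ hx hy => exact add_mem_cadlagBV hx hy
  | smul c x _ hx => exact smul_mem_cadlagBV c hx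

/-- The population score vanishes at the risk minimizer. -/
theorem integral_score_riskMinimizer {d k : ℕ} {𝒪 : Type*} [MeasurableSpace 𝒪] {P₀ : Measure 𝒪}
    {L : (Cube d → ℝ) → 𝒪 → ℝ} {ψ₀ : Cube d → ℝ} (hψ₀ : IsRiskMinimizer P₀ L ψ₀)
    (hL₀ : HasScoreAt P₀ L ψ₀ (splineSpace d k)) {f : Cube d → ℝ} (hf : f ∈ splineSpace d k) :
    ∫ o, score L ψ₀ f o ∂P₀ = 0 := by
  -- The whole line `ψ₀ + δ f` is admissible, so `δ = 0` is a local minimum as soon as the losses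
  -- along it are integrable.
  refine IsLocalMin.hasDerivAt_eq_zero ?_ (hL₀.hasDerivAt f hf)
  filter_upwards [hL₀.integrable_loss f hf] with δ hδ
  have h := hψ₀.2.2 (ψ₀ + δ • f) (add_mem_cadlagBV hψ₀.1
    (smul_mem_cadlagBV δ (splineSpace_subset_cadlagBV hf))) hδ
  simpa using h

theorem measurable_spline {d k : ℕ} (b : Fin d → SplineFactor k) : Measurable (spline b) :=
  Finset.measurable_prod _ fun j _ => (b j).eval_monotone.measurable.comp (measurable_pi_apply j)

theorem abs_spline_le_one {d k : ℕ} (b : Fin d → SplineFactor k) (x : Cube d) :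
    |spline b x| ≤ 1 := by
  rw [spline, abs_of_nonneg (Finset.prod_nonneg fun j _ => (b j).eval_nonneg _)]
  exact Finset.prod_le_one (fun j _ => (b j).eval_nonneg _) fun j _ => (b j).eval_le_one _

/-! ## The working model and the score as linear maps of the coefficients -/

section WorkingModel

variable {d k : ℕ} (B : PCModel d k)

theorem PCModel.theta_eq_sum (a : Fin B.q → ℝ) :
    B.theta a = ∑ i, a i • ∑ j, B.E j i • spline (B.basis j) := by
  funext x
  simp [PCModel.theta, PCModel.pc]

theorem PCModel.theta_mem (a : Fin B.q → ℝ) : B.theta a ∈ splineSpace d k := by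
  rw [B.theta_eq_sum]
  exact Submodule.sum_mem _ fun i _ => Submodule.smul_mem _ _ <|
    Submodule.sum_mem _ fun j _ => Submodule.smul_mem _ _ <|
      Submodule.subset_span (Set.mem_range_self _)

theorem PCModel.theta_add (a b : Fin B.q → ℝ) : B.theta (a + b) = B.theta a + B.theta b := by
  funext x
  simp [PCModel.theta, add_mul, Finset.sum_add_distrib]

theorem PCModel.theta_smul (c : ℝ) (a : Fin B.q → ℝ) : B.theta (c • a) = c • B.theta a := by
  funext x
  simp [PCModel.theta, Finset.mul_sum, mul_assoc]

theorem PCModel.measurable_theta (a : Fin B.q → ℝ) : Measurable (B.theta a) := by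
  unfold PCModel.theta PCModel.pc
  exact Finset.measurable_sum _ fun i _ => (Finset.measurable_sum _ fun j _ =>
    (measurable_spline (B.basis j)).const_mul (B.E j i)).const_mul (a i)

theorem PCModel.exists_abs_theta_le (a : Fin B.q → ℝ) : ∃ c, ∀ x, |B.theta a x| ≤ c := by
  refine ⟨∑ i, |a i| * ∑ j, |B.E j i|, fun x => ?_⟩
  refine (Finset.abs_sum_le_sum_abs _ _).trans (Finset.sum_le_sum fun i _ => ?_)
  rw [abs_mul]
  refine mul_le_mul_of_nonneg_left ((Finset.abs_sum_le_sum_abs _ _).trans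
    (Finset.sum_le_sum fun j _ => ?_)) (abs_nonneg _)
  rw [abs_mul]
  exact mul_le_of_le_one_right (abs_nonneg _) (abs_spline_le_one _ _)

end WorkingModel

/-! ### Linearity of the empirical score in the direction. -/

section ScoreLinear

variable {𝒪 Ω : Type*} {d k : ℕ}

/-- Homogeneity needs no differentiability: rescaling the argument scales `deriv` even where it
takes its default value. This is why `HasLinearScore` asks for additivity only. -/
theorem score_smul (L : (Cube d → ℝ) → 𝒪 → ℝ) (θ f : Cube d → ℝ) (c : ℝ) (o : 𝒪) :
    score L θ (c • f) o = c * score L θ f o := by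
  have h := deriv_comp_mul_left c (fun δ : ℝ => L (θ + δ • f) o) 0
  simp only [mul_zero, smul_eq_mul] at h
  rw [score, score, ← h]
  simp only [mul_smul, smul_comm c]

theorem empMean_score_smul (O : ℕ → Ω → 𝒪) (n : ℕ) (ω : Ω) (B : PCModel d k) (a : Fin B.q → ℝ)
    (L : (Cube d → ℝ) → 𝒪 → ℝ) (c : ℝ) (f : Fin B.q → ℝ) :
    empMean O n ω (score L (B.theta a) (B.theta (c • f))) =
      c * empMean O n ω (score L (B.theta a) (B.theta f)) := by
  simp only [empMean, B.theta_smul, score_smul, ← Finset.mul_sum]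
  ring

variable [MeasurableSpace 𝒪] {L : (Cube d → ℝ) → 𝒪 → ℝ} (hL : HasLinearScore L (splineSpace d k))
  (O : ℕ → Ω → 𝒪) (n : ℕ) (ω : Ω) (B : PCModel d k) (a : Fin B.q → ℝ)

include hL in
theorem empMean_score_add (f g : Fin B.q → ℝ) :
    empMean O n ω (score L (B.theta a) (B.theta (f + g))) =
      empMean O n ω (score L (B.theta a) (B.theta f)) +
        empMean O n ω (score L (B.theta a) (B.theta g)) := by
  simp only [empMean, ← mul_add, ← Finset.sum_add_distrib, B.theta_add,
    hL.add _ (B.theta_mem a) _ (B.theta_mem f) _ (B.theta_mem g)]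

theorem hasDerivAt_empMean (v : Fin B.q → ℝ) (hL : HasLinearScore L (splineSpace d k)) :
    HasDerivAt (fun δ : ℝ => empMean O n ω (L (B.theta (a + δ • v))))
      (empMean O n ω (score L (B.theta a) (B.theta v))) 0 := by
  unfold empMean
  refine HasDerivAt.const_mul _ (HasDerivAt.fun_sum fun _ _ => ?_)
  simp only [B.theta_add, B.theta_smul]
  exact (hL.differentiable _ (B.theta_mem a) _ (B.theta_mem v) _).hasDerivAt

end ScoreLinear

/-! ### Euclidean geometry of the coefficient ball. -/

section Coefficients

variable {q : ℕ}

theorem norm2_sq (a : Fin q → ℝ) : norm2 a ^ 2 = ∑ i, a i ^ 2 :=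
  Real.sq_sqrt (Finset.sum_nonneg fun _ _ => sq_nonneg _)

theorem norm2_nonneg (a : Fin q → ℝ) : 0 ≤ norm2 a := Real.sqrt_nonneg _

theorem norm2_le_iff {a : Fin q → ℝ} {C : ℝ} (hC : 0 ≤ C) :
    norm2 a ≤ C ↔ ∑ i, a i ^ 2 ≤ C ^ 2 := Real.sqrt_le_left hC

theorem norm2_pos {a : Fin q → ℝ} {i : Fin q} (hi : a i ≠ 0) : 0 < norm2 a :=
  Real.sqrt_pos.2 (Finset.sum_pos' (fun j _ => sq_nonneg _) ⟨i, Finset.mem_univ i, by positivity⟩)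

theorem activeCard_pos {a : Fin q → ℝ} {i : Fin q} (hi : a i ≠ 0) : 0 < activeCard a :=
  Finset.card_pos.2 ⟨i, by simp [hi]⟩

theorem ip_comm (a b : Fin q → ℝ) : ip a b = ip b a := by simp [ip, mul_comm]

theorem ip_sub_left (a b c : Fin q → ℝ) : ip (a - b) c = ip a c - ip b c := by
  simp [ip, sub_mul]

theorem ip_smul_left (r : ℝ) (a c : Fin q → ℝ) : ip (r • a) c = r * ip a c := by
  simp [ip, Finset.mul_sum, mul_assoc]

theorem ip_self (a : Fin q → ℝ) : ip a a = norm2 a ^ 2 := by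
  rw [norm2_sq]; simp [ip, sq]

theorem unitDir_eq_smul (a : Fin q → ℝ) : unitDir a = (norm2 a)⁻¹ • a := by
  funext i; simp [unitDir, div_eq_inv_mul]

theorem starDir_eq_smul (a : Fin q → ℝ) :
    starDir a = (Real.sqrt (activeCard a))⁻¹ • unitDir a := by
  funext i; simp [starDir, div_eq_inv_mul]

theorem abs_ip_unitDir_le (a f : Fin q → ℝ) : |ip f (unitDir a)| ≤ norm2 f := by
  have hcs : (ip f a) ^ 2 ≤ norm2 f ^ 2 * norm2 a ^ 2 := by
    rw [norm2_sq, norm2_sq]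
    exact Finset.sum_mul_sq_le_sq_mul_sq _ _ _
  have hcs' : |ip f a| ≤ norm2 f * norm2 a := by
    rw [← mul_pow] at hcs
    exact abs_le_of_sq_le_sq hcs (mul_nonneg (norm2_nonneg f) (norm2_nonneg a))
  rw [unitDir_eq_smul, ip_comm, ip_smul_left, abs_mul, abs_inv, abs_of_nonneg (norm2_nonneg a),
    ip_comm]
  rcases (norm2_nonneg a).eq_or_lt with h | h
  · simp [← h, norm2_nonneg]
  · rw [inv_mul_le_iff₀ h, mul_comm]
    exact hcs'

/-- With `δ` factored out, the sign of the bracket near `δ = 0` decides whether the step shortens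
`a`. -/
theorem sum_sq_add_smul (a v : Fin q → ℝ) (δ : ℝ) :
    ∑ i, (a + δ • v) i ^ 2 = norm2 a ^ 2 + δ * (2 * ip v a + δ * norm2 v ^ 2) := by
  rw [norm2_sq, norm2_sq]
  simp only [ip, Pi.add_apply, Pi.smul_apply, smul_eq_mul, Finset.mul_sum,
    ← Finset.sum_add_distrib]
  exact Finset.sum_congr rfl fun i _ => by ring

/-- Feasibility of directions that point into the ball. -/
theorem eventually_norm2_add_smul_le {a v : Fin q → ℝ} {C : ℝ} (hC : 0 < C) (ha : norm2 a ≤ C)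
    (h : norm2 a < C ∨ ip v a < 0) : ∀ᶠ δ : ℝ in 𝓝[>] 0, norm2 (a + δ • v) ≤ C := by
  simp only [norm2_le_iff hC.le, sum_sq_add_smul]
  rcases h with h | h
  · have hc : ContinuousAt
        (fun δ : ℝ => norm2 a ^ 2 + δ * (2 * ip v a + δ * norm2 v ^ 2)) 0 := by fun_prop
    have h0 : norm2 a ^ 2 + 0 * (2 * ip v a + 0 * norm2 v ^ 2) < C ^ 2 := by
      rw [zero_mul, add_zero]
      exact pow_lt_pow_left₀ h (norm2_nonneg a) two_ne_zero
    exact ((hc.eventually_lt_const h0).mono fun _ => le_of_lt).filter_mono nhdsWithin_le_nhds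
  · have hc : ContinuousAt (fun δ : ℝ => 2 * ip v a + δ * norm2 v ^ 2) 0 := by fun_prop
    have h0 : 2 * ip v a + 0 * norm2 v ^ 2 < 0 := by linarith
    filter_upwards [(hc.eventually_lt_const h0).filter_mono nhdsWithin_le_nhds,
      self_mem_nhdsWithin] with δ hδ hδ0
    have h1 : norm2 a ^ 2 ≤ C ^ 2 := pow_le_pow_left₀ (norm2_nonneg a) ha 2
    have h2 := mul_neg_of_pos_of_neg (Set.mem_Ioi.1 hδ0) hδ
    linarith

end Coefficients

/-! ### First-order conditions on the ball. -/

section ScoreEquations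

variable {𝒪 Ω : Type*} {d k : ℕ} [MeasurableSpace 𝒪] {L : (Cube d → ℝ) → 𝒪 → ℝ}
  (hL : HasLinearScore L (splineSpace d k)) {O : ℕ → Ω → 𝒪} {n : ℕ} {ω : Ω} {B : PCModel d k}
  {C : ℝ} (hC : 0 < C) {a : Fin B.q → ℝ} (ha : IsPCHAR L O n ω B C a)

include hL hC ha

/-- Only small `δ > 0` are feasible, so the derivative is used as a limit of right slopes, each
nonnegative by minimality. -/
theorem IsPCHAR.empMean_score_nonneg {v : Fin B.q → ℝ} (hv : norm2 a < C ∨ ip v a < 0) :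
    0 ≤ empMean O n ω (score L (B.theta a) (B.theta v)) := by
  have h := (hasDerivAt_empMean O n ω B a v hL).tendsto_slope_zero_right
  refine ge_of_tendsto h ?_
  filter_upwards [eventually_norm2_add_smul_le hC ha.1 hv, self_mem_nhdsWithin] with δ hδ hδ0
  have h1 := ha.2 _ hδ
  simp only [zero_add, zero_smul, add_zero, smul_eq_mul]
  exact mul_nonneg (inv_nonneg.2 (le_of_lt hδ0)) (sub_nonneg.2 h1)

theorem IsPCHAR.empMean_score_nonneg_of_ip_eq_zero {h : Fin B.q → ℝ} (hh : ip h a = 0) :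
    0 ≤ empMean O n ω (score L (B.theta a) (B.theta h)) := by
  rcases lt_or_eq_of_le ha.1 with hlt | heq
  · exact ha.empMean_score_nonneg hL hC (Or.inl hlt)
  · set G := fun v : Fin B.q → ℝ => empMean O n ω (score L (B.theta a) (B.theta v)) with hG
    -- On the sphere `a + δ h` leaves the ball for `h ≠ 0`. The tilt `h - ε a` has inner product `-ε
    -- C² < 0` with `a`, and its score is affine in `ε`.
    have key : ∀ ε : ℝ, 0 < ε → 0 ≤ G h + (-ε) * G a := by
      intro ε hε
      have h1 : ip (h + (-ε) • a) a < 0 := by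
        have : h + (-ε) • a = h - ε • a := by rw [neg_smul, sub_eq_add_neg]
        rw [this, ip_sub_left, hh, ip_smul_left, ip_self, heq]
        have := mul_pos hε (pow_pos hC 2)
        linarith
      have h2 := ha.empMean_score_nonneg hL hC (Or.inr h1)
      rwa [empMean_score_add hL, empMean_score_smul] at h2
    have hc : Tendsto (fun ε : ℝ => G h + (-ε) * G a) (𝓝[>] 0) (𝓝 (G h + (-0) * G a)) :=
      (Continuous.tendsto (by fun_prop) _).mono_left nhdsWithin_le_nhds
    rw [neg_zero, zero_mul, add_zero] at hc
    exact ge_of_tendsto hc (eventually_nhdsWithin_of_forall fun ε hε => key ε hε)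

/-- The score equations in the directions orthogonal to the estimator. -/
theorem IsPCHAR.empMean_score_eq_zero {h : Fin B.q → ℝ} (hh : ip h a = 0) :
    empMean O n ω (score L (B.theta a) (B.theta h)) = 0 := by
  refine le_antisymm ?_ (ha.empMean_score_nonneg_of_ip_eq_zero hL hC hh)
  have h1 : ip ((-1 : ℝ) • h) a = 0 := by rw [ip_smul_left, hh, mul_zero]
  have h2 := ha.empMean_score_nonneg_of_ip_eq_zero hL hC h1
  rw [empMean_score_smul] at h2
  linarith

theorem IsPCHAR.empMean_score_starDir {t : Fin B.q → ℝ} (ht : t ∈ tangentDirs a) :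
    empMean O n ω (score L (B.theta a) (B.theta (starDir a))) =
      empMean O n ω (score L (B.theta a) (B.theta (starDir a - t))) := by
  have hta : ip t a = 0 := by
    -- For `a = 0` the unit direction is zero by convention and `ht` carries no information, but the
    -- claim is trivial.
    rcases (norm2_nonneg a).eq_or_lt with h | h
    · have : ∀ i, a i = 0 := fun i => by
        by_contra hi
        exact (norm2_pos hi).ne h
      simp [ip, this]
    · have h1 := ht.2
      rw [unitDir_eq_smul, ip_comm, ip_smul_left, ip_comm] at h1
      exact (mul_eq_zero.1 h1).resolve_left (inv_pos.2 h).ne'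
  have h1 := empMean_score_add hL O n ω B a (starDir a - t) t
  rw [sub_add_cancel, ha.empMean_score_eq_zero hL hC hta, add_zero] at h1
  exact h1

/-- The score equation in a general direction of the active submodel. -/
theorem IsPCHAR.empMean_score_eq {t : Fin B.q → ℝ} (ht : t ∈ tangentDirs a) {f : Fin B.q → ℝ}
    (hf : ActiveIn a f) :
    empMean O n ω (score L (B.theta a) (B.theta f)) =
      Real.sqrt (activeCard a) * ip f (unitDir a) *
        empMean O n ω (score L (B.theta a) (B.theta (starDir a - t))) := by
  rw [← ha.empMean_score_starDir hL hC ht]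
  by_cases hz : ∃ i, a i ≠ 0
  · obtain ⟨i, hi⟩ := hz
    have hJ : (Real.sqrt (activeCard a)) ≠ 0 :=
      (Real.sqrt_pos.2 (by exact_mod_cast activeCard_pos hi)).ne'
    have hn := (norm2_pos hi).ne'
    have hu : ip (unitDir a) a = norm2 a := by
      rw [unitDir_eq_smul, ip_smul_left, ip_self]
      field_simp
    -- Only the component of `f` along the unit direction contributes to the score; the rest lies in
    -- the hyperplane where the score vanishes.
    have hort : ip (f - ip f (unitDir a) • unitDir a) a = 0 := by
      rw [ip_sub_left, ip_smul_left, hu, unitDir_eq_smul, ip_comm f (_ • a), ip_smul_left,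
        ip_comm a f]
      field_simp
      ring
    have h1 := empMean_score_add hL O n ω B a (f - ip f (unitDir a) • unitDir a)
      (ip f (unitDir a) • unitDir a)
    rw [sub_add_cancel, ha.empMean_score_eq_zero hL hC hort, zero_add, empMean_score_smul] at h1
    rw [h1, starDir_eq_smul, empMean_score_smul]
    field_simp
  -- If `a = 0` the active set is empty, so `f = 0`, and `√J = 0` makes the other side vanish too.
  · have hz' : ∀ i, a i = 0 := by simpa using hz
    have hf0 : f = (0 : ℝ) • f := by
      funext i
      simp [hf i (hz' i)]
    have hJ : activeCard a = 0 := by simp [activeCard, hz']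
    rw [hJ, hf0, empMean_score_smul]
    simp

theorem IsPCHAR.abs_empMean_score_le {t : Fin B.q → ℝ} (ht : t ∈ tangentDirs a)
    {f : Fin B.q → ℝ} (hf : ActiveIn a f) (hf' : norm2 f ≤ (Real.sqrt (activeCard a))⁻¹) :
    |empMean O n ω (score L (B.theta a) (B.theta f))| ≤
      |empMean O n ω (score L (B.theta a) (B.theta (starDir a - t)))| := by
  rw [ha.empMean_score_eq hL hC ht hf, abs_mul]
  refine mul_le_of_le_one_left (abs_nonneg _) ?_
  rw [abs_mul, abs_of_nonneg (Real.sqrt_nonneg _)]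
  refine (mul_le_mul_of_nonneg_left ((abs_ip_unitDir_le a f).trans hf')
    (Real.sqrt_nonneg _)).trans ?_
  exact mul_inv_le_one

end ScoreEquations

/-! ## The projection error -/

section ProjectionError

variable {𝒪 : Type*} {d k : ℕ} [MeasurableSpace 𝒪] {P₀ : Measure 𝒪}
  {X : 𝒪 → Cube d} {B : PCModel d k} {a : Fin B.q → ℝ}

theorem PCModel.theta_single (i : Fin B.q) (c : ℝ) (x : Cube d) :
    B.theta (c • Pi.single i 1) x = c * B.pc i x := by
  rw [B.theta_smul]
  simp [PCModel.theta, Pi.single_apply]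

/-- Moving `f_a^*` along a single coordinate into the orthogonal complement of `a`. -/
theorem exists_mem_tangentDirs {i : Fin B.q} (hi : a i ≠ 0) :
    ∃ h ∈ tangentDirs a, ∃ c : ℝ, |c| = cConst a i ∧ starDir a - h = c • Pi.single i 1 := by
  have hJ : 0 < Real.sqrt (activeCard a) :=
    Real.sqrt_pos.2 (by exact_mod_cast activeCard_pos hi)
  have hn := norm2_pos hi
  -- The quotient of `⟨f_a^*, f_a⟩ = J^{-1/2}` by `⟨e_i, f_a⟩ = a_i / ‖a‖`: the only multiple of
  -- `e_i` whose removal leaves a vector orthogonal to `a`.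
  set c := norm2 a / (Real.sqrt (activeCard a) * a i) with hc
  refine ⟨starDir a - c • Pi.single i 1, ⟨fun j hj => ?_, ?_⟩, c, ?_, sub_sub_cancel _ _⟩
  · have hji : j ≠ i := fun h => hi (h ▸ hj)
    simp [starDir, unitDir, hj, hji]
  · have h1 : ip (unitDir a) (unitDir a) = 1 := by
      rw [unitDir_eq_smul, ip_smul_left, ip_comm, ip_smul_left, ip_self]
      field_simp
    have h2 : ip (Pi.single i (1 : ℝ)) (unitDir a) = a i / norm2 a := by
      simp [ip, Pi.single_apply, unitDir]
    rw [ip_sub_left, ip_smul_left, h2, starDir_eq_smul, ip_smul_left, h1, hc]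
    field_simp
    ring
  · rw [hc, abs_div, abs_mul, abs_of_pos hn, abs_of_pos hJ, cConst]

theorem eLpNorm_theta_smul_single (p : ℝ≥0∞) (i : Fin B.q) (c : ℝ) :
    eLpNorm (fun o => B.theta (c • Pi.single i 1) (X o)) p P₀ =
      ENNReal.ofReal |c| * eLpNorm (fun o => B.pc i (X o)) p P₀ := by
  have h : (fun o => B.theta (c • Pi.single i 1) (X o)) = c • fun o => B.pc i (X o) := by
    funext o
    simp [PCModel.theta_single]
  rw [h, eLpNorm_const_smul, Real.enorm_eq_ofReal_abs]

theorem memLp_theta [IsFiniteMeasure P₀] (hX : Measurable X) (f : Fin B.q → ℝ) (p : ℝ≥0∞) :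
    MemLp (fun o => B.theta f (X o)) p P₀ := by
  obtain ⟨c, hc⟩ := B.exists_abs_theta_le f
  exact MemLp.of_bound ((B.measurable_theta f).comp hX).aestronglyMeasurable c
    (ae_of_all _ fun o => hc _)

theorem eLpNorm_two_le_eLpNorm_two {f g : 𝒪 → ℝ} (hf : MemLp f 2 P₀) (hg : MemLp g 2 P₀)
    (h : ∫ o, f o ^ 2 ∂P₀ ≤ ∫ o, g o ^ 2 ∂P₀) : eLpNorm f 2 P₀ ≤ eLpNorm g 2 P₀ := by
  rw [hf.eLpNorm_eq_integral_rpow_norm two_ne_zero ENNReal.ofNat_ne_top,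
    hg.eLpNorm_eq_integral_rpow_norm two_ne_zero ENNReal.ofNat_ne_top]
  refine ENNReal.ofReal_le_ofReal (Real.rpow_le_rpow
    (integral_nonneg fun o => by positivity) ?_ (by simp))
  simpa using h

theorem IsL2Projection.eLpNorm_le [IsFiniteMeasure P₀] (hX : Measurable X) {t : Fin B.q → ℝ}
    (ht : IsL2Projection P₀ X B a t) {h : Fin B.q → ℝ} (hh : h ∈ tangentDirs a) :
    eLpNorm (fun o => B.theta (starDir a - t) (X o)) 2 P₀ ≤
      eLpNorm (fun o => B.theta (starDir a - h) (X o)) 2 P₀ := by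
  refine eLpNorm_two_le_eLpNorm_two (memLp_theta hX _ _) (memLp_theta hX _ _) ?_
  have hsub : ∀ (u : Fin B.q → ℝ) x, B.theta (starDir a - u) x =
      B.theta (starDir a) x - B.theta u x := fun u x => by
    simp [PCModel.theta, sub_mul]
  simp only [hsub]
  exact ht.2 h hh

end ProjectionError

/-! ## Rademacher averages and chaining -/

section Rademacher

variable {ι κ : Type*} {n : ℕ}

/-- The sign `±1`. -/
def rademacherSign (b : Bool) : ℝ := if b then 1 else -1

theorem abs_rademacherSign (b : Bool) : |rademacherSign b| = 1 := by
  cases b <;> simp [rademacherSign]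

/-- The mean of `max_{i ∈ S} |∑_j s_j v_i(j)|` over all sign vectors `s`. -/
noncomputable def rademacherMax (S : Finset ι) (v : ι → Fin n → ℝ) : ℝ≥0∞ :=
  (2 ^ n : ℝ≥0∞)⁻¹ *
    ∑ s : Fin n → Bool, S.sup fun i => ‖∑ j, rademacherSign (s j) * v i j‖ₑ

/-- The maximum sees only the image of the index set. In the chaining this replaces `S` by pairs of
net points, whose number does not depend on `S`. -/
theorem rademacherMax_comp (S : Finset ι) (f : ι → κ) [DecidableEq κ] (v : κ → Fin n → ℝ) :
    rademacherMax S (fun i => v (f i)) = rademacherMax (S.image f) v := by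
  simp only [rademacherMax, Finset.sup_image]
  rfl

theorem finset_sup_add_le (S : Finset ι) (f g : ι → ℝ≥0∞) :
    (S.sup fun i => f i + g i) ≤ S.sup f + S.sup g :=
  Finset.sup_le fun _ hi => add_le_add (Finset.le_sup hi) (Finset.le_sup hi)

theorem rademacherMax_add_le (S : Finset ι) (v w : ι → Fin n → ℝ) :
    rademacherMax S (v + w) ≤ rademacherMax S v + rademacherMax S w := by
  simp only [rademacherMax, ← mul_add, ← Finset.sum_add_distrib]
  refine mul_le_mul' le_rfl (Finset.sum_le_sum fun s _ => ?_)
  refine le_trans (Finset.sup_mono_fun fun i _ => ?_) (finset_sup_add_le S _ _)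
  simp only [Pi.add_apply, mul_add, Finset.sum_add_distrib]
  exact enorm_add_le _ _

theorem inv_two_pow_mul_sum_const (c : ℝ≥0∞) :
    (2 ^ n : ℝ≥0∞)⁻¹ * ∑ _s : Fin n → Bool, c = c := by
  simp only [Finset.sum_const, Finset.card_univ, Fintype.card_pi, Fintype.card_bool,
    Finset.prod_const, Fintype.card_fin, nsmul_eq_mul]
  push_cast
  rw [← mul_assoc, ENNReal.inv_mul_cancel (by simp) (by simp), one_mul]

theorem rademacherMax_le_of_sum_abs_le {S : Finset ι} {v : ι → Fin n → ℝ} {c : ℝ}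
    (h : ∀ i ∈ S, ∑ j, |v i j| ≤ c) : rademacherMax S v ≤ ENNReal.ofReal c := by
  rw [← inv_two_pow_mul_sum_const (n := n) (ENNReal.ofReal c)]
  refine mul_le_mul' le_rfl (Finset.sum_le_sum fun s _ => Finset.sup_le fun i hi => ?_)
  rw [Real.enorm_eq_ofReal_abs]
  refine ENNReal.ofReal_le_ofReal (le_trans (Finset.abs_sum_le_sum_abs _ _) ?_)
  simpa [abs_mul, abs_rademacherSign] using h i hi

/-- Independence of the signs turns the sum into a product of `2 cosh (v j)`, and `cosh x ≤ exp (x²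
/ 2)`. -/
theorem sum_exp_rademacher_le (v : Fin n → ℝ) :
    ∑ s : Fin n → Bool, Real.exp (∑ j, rademacherSign (s j) * v j) ≤
      2 ^ n * Real.exp ((∑ j, v j ^ 2) / 2) := by
  have h1 : ∑ s : Fin n → Bool, Real.exp (∑ j, rademacherSign (s j) * v j) =
      ∏ j, (2 * Real.cosh (v j)) := by
    simp only [Real.exp_sum]
    rw [← Fintype.prod_sum (fun (j : Fin n) (b : Bool) => Real.exp (rademacherSign b * v j))]
    refine Finset.prod_congr rfl fun j _ => ?_
    rw [Fintype.sum_bool, Real.cosh_eq]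
    simp [rademacherSign]
    ring
  rw [h1, Finset.prod_mul_distrib, Finset.prod_const, Finset.card_univ, Fintype.card_fin,
    Finset.sum_div, Real.exp_sum]
  exact mul_le_mul_of_nonneg_left (Finset.prod_le_prod (fun j _ => (Real.cosh_pos _).le)
    fun j _ => Real.cosh_le_exp_half_sq _) (by positivity)

/-- The maximal inequality for finitely many Rademacher averages. -/
theorem rademacherMax_le {S : Finset ι} {v : ι → Fin n → ℝ} {σ l : ℝ} (hσ : 0 < σ) (hl : 0 < l)
    (hv : ∀ i ∈ S, ∑ j, v i j ^ 2 ≤ σ ^ 2) (hS : 2 * (S.card : ℝ) ≤ Real.exp l) :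
    rademacherMax S v ≤ ENNReal.ofReal (σ * Real.sqrt (2 * l)) := by
  rcases S.eq_empty_or_nonempty with rfl | hne
  · simp [rademacherMax]
  -- The optimal exponential parameter: `t² σ² / 2 = l`, so each one-sided exponential moment is at
  -- most `exp l`.
  set t := Real.sqrt (2 * l) / σ with ht
  have hsq : 0 < Real.sqrt (2 * l) := Real.sqrt_pos.2 (by linarith)
  have ht0 : 0 < t := div_pos hsq hσ
  have htσ : t ^ 2 * σ ^ 2 = 2 * l := by
    rw [ht, div_pow, Real.sq_sqrt (by linarith)]
    field_simp
  set x : ι → (Fin n → Bool) → ℝ := fun i s => ∑ j, rademacherSign (s j) * v i j with hx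
  -- The tangent inequality `y ≤ 2 l - 1 + exp (y - 2 l)` at `y = t |x|` takes the place of Jensen
  -- for the logarithm. The exponential sum has mean at most `2 |S| exp l ≤ exp (2 l)`, so `h` has
  -- mean at most `2 l / t = σ √(2 l)`.
  set h : (Fin n → Bool) → ℝ := fun s =>
    (2 * l + (∑ i ∈ S, (Real.exp (t * x i s) + Real.exp (-(t * x i s)))) / Real.exp (2 * l) - 1) / t
    with hh
  have hle : ∀ s, ∀ i ∈ S, |x i s| ≤ h s := by
    intro s i hi
    rw [hh, le_div_iff₀ ht0]
    have h1 : Real.exp (t * |x i s|) ≤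
        ∑ i ∈ S, (Real.exp (t * x i s) + Real.exp (-(t * x i s))) := by
      refine le_trans ?_ (Finset.single_le_sum (f := fun i =>
        Real.exp (t * x i s) + Real.exp (-(t * x i s))) (fun i _ => by positivity) hi)
      rcases abs_cases (x i s) with ⟨h, _⟩ | ⟨h, _⟩
      · rw [h]; linarith [Real.exp_pos (-(t * x i s))]
      · rw [h, mul_neg]; linarith [Real.exp_pos (t * x i s)]
    have h2 := Real.add_one_le_exp (t * |x i s| - 2 * l)
    rw [Real.exp_sub] at h2
    have h3 := div_le_div_of_nonneg_right h1 (Real.exp_pos (2 * l)).le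
    linarith
  have hh0 : ∀ s, 0 ≤ h s := fun s => by
    obtain ⟨i, hi⟩ := hne
    exact (abs_nonneg _).trans (hle s i hi)
  have hexp : ∀ i ∈ S, ∑ s, (Real.exp (t * x i s) + Real.exp (-(t * x i s))) ≤
      2 * (2 ^ n * Real.exp l) := by
    intro i hi
    have hb : ∀ c : ℝ, c ^ 2 = t ^ 2 → ∑ s, Real.exp (c * x i s) ≤ 2 ^ n * Real.exp l := by
      intro c hc
      have := sum_exp_rademacher_le fun j => c * v i j
      have h1 : ∀ s : Fin n → Bool, ∑ j, rademacherSign (s j) * (c * v i j) = c * x i s := by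
        intro s
        rw [hx, Finset.mul_sum]
        exact Finset.sum_congr rfl fun j _ => by ring
      simp only [h1, mul_pow, ← Finset.mul_sum, hc] at this
      refine this.trans (mul_le_mul_of_nonneg_left (Real.exp_le_exp.2 ?_) (by positivity))
      have := mul_le_mul_of_nonneg_left (hv i hi) (sq_nonneg t)
      linarith
    rw [Finset.sum_add_distrib]
    have h1 := hb t rfl
    have h2 := hb (-t) (by ring)
    simp only [neg_mul] at h2
    linarith
  have hsum : ∑ s, h s ≤ 2 ^ n * (σ * Real.sqrt (2 * l)) := by
    have h1 : ∑ s, h s = (2 ^ n * (2 * l - 1) + (∑ i ∈ S, ∑ s,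
        (Real.exp (t * x i s) + Real.exp (-(t * x i s)))) / Real.exp (2 * l)) / t := by
      rw [Finset.sum_comm, hh, ← Finset.sum_div]
      congr 1
      rw [Finset.sum_sub_distrib, Finset.sum_add_distrib, Finset.sum_div]
      simp
      ring
    have h2 : (∑ i ∈ S, ∑ s, (Real.exp (t * x i s) + Real.exp (-(t * x i s)))) ≤
        2 ^ n * Real.exp (2 * l) := by
      refine (Finset.sum_le_sum hexp).trans ?_
      rw [Finset.sum_const, nsmul_eq_mul, two_mul l, Real.exp_add]
      have := mul_le_mul_of_nonneg_right hS
        (show 0 ≤ 2 ^ n * Real.exp l by positivity)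
      linarith
    have h3 := (div_le_iff₀ (Real.exp_pos (2 * l))).2 h2
    rw [h1, div_le_iff₀ ht0]
    have h4 : σ * Real.sqrt (2 * l) * t = 2 * l := by
      rw [ht, mul_div_assoc', mul_assoc, Real.mul_self_sqrt (by linarith)]
      field_simp
    rw [mul_assoc, h4]
    linarith
  calc rademacherMax S v ≤ (2 ^ n : ℝ≥0∞)⁻¹ * ∑ s, ENNReal.ofReal (h s) := by
        refine mul_le_mul' le_rfl (Finset.sum_le_sum fun s _ => Finset.sup_le fun i hi => ?_)
        rw [Real.enorm_eq_ofReal_abs]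
        exact ENNReal.ofReal_le_ofReal (hle s i hi)
    _ ≤ (2 ^ n : ℝ≥0∞)⁻¹ * (2 ^ n * ENNReal.ofReal (σ * Real.sqrt (2 * l))) := by
        refine mul_le_mul' le_rfl ?_
        rw [← ENNReal.ofReal_sum_of_nonneg fun s _ => hh0 s]
        refine (ENNReal.ofReal_le_ofReal hsum).trans ?_
        rw [ENNReal.ofReal_mul (by positivity), ENNReal.ofReal_pow (by norm_num)]
        simp
    _ = ENNReal.ofReal (σ * Real.sqrt (2 * l)) := by
        rw [← mul_assoc, ENNReal.inv_mul_cancel (by simp) (by simp), one_mul]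

end Rademacher

/-! ### Chaining along dyadic radii. -/

section Chaining

variable {ι : Type*} {n : ℕ}

/-- The constant of the entropy integral bound. -/
noncomputable def chainingConst (γ : ℝ) : ℝ := 4 * Real.sqrt 6 / (1 - 2⁻¹ ^ (1 - γ / 2))

theorem chainingConst_pos {γ : ℝ} (hγ : γ < 2) : 0 < chainingConst γ := by
  have : (2⁻¹ : ℝ) ^ (1 - γ / 2) < 1 :=
    Real.rpow_lt_one (by norm_num) (by norm_num) (by linarith)
  have h6 : 0 < Real.sqrt 6 := Real.sqrt_pos.2 (by norm_num)
  unfold chainingConst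
  apply div_pos <;> linarith

/-- One link of the chain. -/
theorem rademacherMax_link_le {S : Finset ι} {p p' : ι → Fin n → ℝ} {v : ι → Fin n → ℝ}
    {T T' : Finset (Fin n → ℝ)} {A γ ε : ℝ} (hn : 0 < n) (hε : 0 < ε) (hA : 1 ≤ A * ε ^ (-γ))
    (hT : (T.card : ℝ) ≤ Real.exp (A * ε ^ (-γ))) (hT' : (T'.card : ℝ) ≤ Real.exp (A * ε ^ (-γ)))
    (hp : ∀ i ∈ S, p i ∈ T ∧ ∑ j, (v i j - p i j) ^ 2 ≤ n * (2 * ε) ^ 2)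
    (hp' : ∀ i ∈ S, p' i ∈ T' ∧ ∑ j, (v i j - p' i j) ^ 2 ≤ n * ε ^ 2) :
    rademacherMax S (fun i => p' i - p i) ≤
      ENNReal.ofReal (4 * Real.sqrt 6 * Real.sqrt A * Real.sqrt n * ε ^ (1 - γ / 2)) := by
  classical
  have hn' : (0 : ℝ) < n := by exact_mod_cast hn
  have hrp : 0 < ε ^ (-γ) := Real.rpow_pos_of_pos hε _
  have hA0 : 0 < A := by
    by_contra h
    have := mul_nonpos_of_nonpos_of_nonneg (not_lt.1 h) hrp.le
    linarith
  have hl : 0 < 3 * (A * ε ^ (-γ)) := by linarith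
  rw [rademacherMax_comp S (fun i => (p i, p' i)) (fun w => w.2 - w.1)]
  have hcard : (S.image fun i => (p i, p' i)).card ≤ T.card * T'.card := by
    rw [← Finset.card_product]
    refine Finset.card_le_card fun w hw => ?_
    obtain ⟨i, hi, rfl⟩ := Finset.mem_image.1 hw
    exact Finset.mk_mem_product (hp i hi).1 (hp' i hi).1
  -- The squared increments sum to at most `2·4nε² + 2nε² ≤ 16nε²`. The pairs contribute two copies
  -- of `A ε^{-γ}` to `l`; the third absorbs the factor 2, since `exp (A ε^{-γ}) ≥ 2`.
  refine (rademacherMax_le (σ := 4 * (Real.sqrt n * ε)) (l := 3 * (A * ε ^ (-γ)))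
    (by positivity) hl ?_ ?_).trans (ENNReal.ofReal_le_ofReal (le_of_eq ?_))
  · intro w hw
    obtain ⟨i, hi, rfl⟩ := Finset.mem_image.1 hw
    have h1 : ∑ j, (p' i - p i) j ^ 2 ≤
        2 * ∑ j, (v i j - p i j) ^ 2 + 2 * ∑ j, (v i j - p' i j) ^ 2 := by
      rw [Finset.mul_sum, Finset.mul_sum, ← Finset.sum_add_distrib]
      refine Finset.sum_le_sum fun j _ => ?_
      rw [Pi.sub_apply]
      nlinarith [sq_nonneg ((v i j - p i j) + (v i j - p' i j))]
    have h2 := (hp i hi).2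
    have h3 := (hp' i hi).2
    have h4 : (4 * (Real.sqrt n * ε)) ^ 2 = 16 * (n * ε ^ 2) := by
      rw [mul_pow, mul_pow, Real.sq_sqrt hn'.le]; norm_num
    have h5 : 0 ≤ n * ε ^ 2 := by positivity
    simp only [h4]
    nlinarith
  · have h1 : ((S.image fun i => (p i, p' i)).card : ℝ) ≤ T.card * T'.card := by
      exact_mod_cast hcard
    have h2 : (T.card : ℝ) * T'.card ≤ Real.exp (A * ε ^ (-γ)) * Real.exp (A * ε ^ (-γ)) :=
      mul_le_mul hT hT' (by positivity) (by positivity)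
    have h3 : (2 : ℝ) ≤ Real.exp (A * ε ^ (-γ)) := by
      linarith [Real.add_one_le_exp (A * ε ^ (-γ))]
    have h4 : Real.exp (3 * (A * ε ^ (-γ))) = Real.exp (A * ε ^ (-γ)) *
        (Real.exp (A * ε ^ (-γ)) * Real.exp (A * ε ^ (-γ))) := by
      rw [← Real.exp_add, ← Real.exp_add]; congr 1; ring
    rw [h4]
    exact mul_le_mul h3 (h1.trans h2) (by positivity) (by positivity)
  · have h1 : 2 * (3 * (A * ε ^ (-γ))) = 6 * A * (ε ^ (-γ / 2)) ^ 2 := by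
      rw [← Real.rpow_natCast, ← Real.rpow_mul hε.le]
      norm_num
      ring
    rw [h1, Real.sqrt_mul (by positivity), Real.sqrt_sq (Real.rpow_nonneg hε.le _),
      Real.sqrt_mul (by norm_num)]
    have h2 : ε ^ (1 - γ / 2) = ε * ε ^ (-γ / 2) := by
      rw [show 1 - γ / 2 = 1 + -γ / 2 by ring, Real.rpow_add hε, Real.rpow_one]
    rw [h2]
    ring

/-- The entropy integral bound for Rademacher averages, under polynomial entropy. -/
theorem rademacherMax_le_of_entropy {S : Finset ι} {v : ι → Fin n → ℝ} {r A γ : ℝ}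
    (hn : 0 < n) (hr : 0 < r) (hγ0 : 0 < γ) (hγ : γ < 2) (hA : 1 ≤ A * r ^ (-γ))
    (hv : ∀ i ∈ S, ∑ j, v i j ^ 2 ≤ n * r ^ 2)
    (hnet : ∀ ε : ℝ, 0 < ε → ε ≤ r → ∃ T : Finset (Fin n → ℝ),
      (T.card : ℝ) ≤ Real.exp (A * ε ^ (-γ)) ∧
        ∀ i ∈ S, ∃ w ∈ T, ∑ j, (v i j - w j) ^ 2 ≤ n * ε ^ 2) :
    rademacherMax S v ≤ ENNReal.ofReal
      (chainingConst γ * Real.sqrt A * Real.sqrt n * r ^ (1 - γ / 2)) := by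
  set e : ℕ → ℝ := fun m => r * 2⁻¹ ^ m with he
  have he0 : ∀ m, 0 < e m := fun m => by positivity
  have her : ∀ m, e m ≤ r := fun m =>
    mul_le_of_le_one_right hr.le (pow_le_one₀ (by norm_num) (by norm_num))
  have hes : ∀ m, e m = 2 * e (m + 1) := fun m => by rw [he]; simp only [pow_succ]; ring
  have hA0 : 0 ≤ A := by
    by_contra h
    have := mul_nonpos_of_nonpos_of_nonneg (not_le.1 h).le (Real.rpow_pos_of_pos hr (-γ)).le
    linarith
  have hexp : ∀ m m', m ≤ m' → A * e m ^ (-γ) ≤ A * e m' ^ (-γ) := fun m m' hm => by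
    refine mul_le_mul_of_nonneg_left (Real.rpow_le_rpow_of_nonpos (he0 _) ?_ (by linarith)) hA0
    exact mul_le_mul_of_nonneg_left
      (pow_le_pow_of_le_one (by norm_num) (by norm_num) hm) hr.le
  have he_zero : e 0 = r := by simp [he]
  have hA1 : ∀ m, 1 ≤ A * e m ^ (-γ) := fun m =>
    (by rw [he_zero]; exact hA : 1 ≤ A * e 0 ^ (-γ)).trans (hexp 0 m (Nat.zero_le m))
  have hnets : ∀ m, ∃ T : Finset (Fin n → ℝ), ∃ p : ι → Fin n → ℝ,
      (T.card : ℝ) ≤ Real.exp (A * e m ^ (-γ)) ∧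
      (∀ i ∈ S, p i ∈ T ∧ ∑ j, (v i j - p i j) ^ 2 ≤ n * e m ^ 2) ∧ (m = 0 → p = 0) := by
    intro m
    rcases Nat.eq_zero_or_pos m with rfl | hm
    -- At the coarsest radius `r` the zero vector is already a net, so the chain starts at 0.
    · refine ⟨{0}, 0, ?_, fun i hi => ⟨by simp, ?_⟩, fun _ => rfl⟩
      · have : (0 : ℝ) ≤ A * e 0 ^ (-γ) := by linarith [hA1 0]
        simpa using this
      · simpa [he_zero] using hv i hi
    · obtain ⟨T, hT, hTS⟩ := hnet (e m) (he0 m) (her m)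
      choose! p hp using hTS
      exact ⟨T, p, hT, hp, fun h => absurd h hm.ne'⟩
  choose T p hT hp hp0 using hnets
  set c := 4 * Real.sqrt 6 * Real.sqrt A * Real.sqrt n with hc
  set ρ : ℝ := 2⁻¹ ^ (1 - γ / 2) with hρ
  have hρ0 : 0 ≤ ρ := Real.rpow_nonneg (by norm_num) _
  -- The decisive use of `γ < 2`: the links decay geometrically.
  have hρ1 : ρ < 1 := Real.rpow_lt_one (by norm_num) (by norm_num) (by linarith)
  have hepow : ∀ m, e m ^ (1 - γ / 2) = r ^ (1 - γ / 2) * ρ ^ m := fun m => by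
    rw [he, hρ]
    simp only
    rw [Real.mul_rpow hr.le (by positivity), ← Real.rpow_natCast, ← Real.rpow_natCast,
      ← Real.rpow_mul (by norm_num), ← Real.rpow_mul (by norm_num), mul_comm (m : ℝ)]
  have hc0 : 0 ≤ c * r ^ (1 - γ / 2) := mul_nonneg (by positivity) (Real.rpow_nonneg hr.le _)
  have hsum0 : ∀ m, 0 ≤ c * r ^ (1 - γ / 2) * ∑ l ∈ Finset.range m, ρ ^ (l + 1) := fun m =>
    mul_nonneg hc0 (Finset.sum_nonneg fun l _ => pow_nonneg hρ0 _)
  have hchain : ∀ m, rademacherMax S (p m) ≤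
      ENNReal.ofReal (c * r ^ (1 - γ / 2) * ∑ l ∈ Finset.range m, ρ ^ (l + 1)) := by
    intro m
    induction m with
    | zero =>
      rw [hp0 0 rfl]
      simp [rademacherMax]
    | succ m ih =>
      have h1 : p (m + 1) = p m + fun i => p (m + 1) i - p m i := by
        funext i; exact (add_sub_cancel _ _).symm
      have h2 := rademacherMax_link_le (v := v) hn (he0 (m + 1)) (hA1 (m + 1))
        ((hT m).trans (Real.exp_le_exp.2 (hexp m (m + 1) (Nat.le_succ m)))) (hT (m + 1))
        (by rw [← hes]; exact hp m) (hp (m + 1))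
      rw [h1]
      refine (rademacherMax_add_le _ _ _).trans ((add_le_add ih h2).trans ?_)
      rw [← ENNReal.ofReal_add (hsum0 m)
          (mul_nonneg (by positivity) (Real.rpow_nonneg (he0 _).le _)),
        Finset.sum_range_succ, hepow]
      exact ENNReal.ofReal_le_ofReal (le_of_eq (by ring))
  -- The end of the chain is bounded trivially by its `ℓ¹` norm, via Cauchy-Schwarz. The bound `n ·
  -- e m` vanishes as `m → ∞` for fixed `n`.
  have hlast : ∀ m, rademacherMax S (v - p m) ≤ ENNReal.ofReal (n * e m) := by
    intro m
    refine rademacherMax_le_of_sum_abs_le fun i hi => ?_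
    have h0 : (∑ j, |v i j - p m i j|) ^ 2 ≤ (n * e m) ^ 2 := by
      have h1 := sq_sum_le_card_mul_sum_sq (s := Finset.univ) (f := fun j => |v i j - p m i j|)
      simp only [sq_abs, Finset.card_univ, Fintype.card_fin] at h1
      have h2 := mul_le_mul_of_nonneg_left (hp m i hi).2 (Nat.cast_nonneg (α := ℝ) n)
      nlinarith
    have := he0 m
    exact (le_abs_self _).trans (abs_le_of_sq_le_sq h0 (by positivity))
  have hgeom : ∀ m, ∑ l ∈ Finset.range m, ρ ^ (l + 1) ≤ (1 - ρ)⁻¹ := by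
    intro m
    have h1 := (summable_geometric_of_lt_one hρ0 hρ1).sum_le_tsum (Finset.range m)
      (fun l _ => pow_nonneg hρ0 l)
    rw [tsum_geometric_of_lt_one hρ0 hρ1] at h1
    refine le_trans (Finset.sum_le_sum fun l _ => ?_) h1
    exact pow_le_pow_of_le_one hρ0 hρ1.le (Nat.le_succ l)
  have hall : ∀ m, rademacherMax S v ≤ ENNReal.ofReal
      (chainingConst γ * Real.sqrt A * Real.sqrt n * r ^ (1 - γ / 2) + n * e m) := by
    intro m
    have h1 : v = p m + (v - p m) := (add_sub_cancel _ _).symm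
    rw [h1]
    refine (rademacherMax_add_le _ _ _).trans ((add_le_add (hchain m) (hlast m)).trans ?_)
    rw [← ENNReal.ofReal_add (hsum0 m) (mul_nonneg (Nat.cast_nonneg n) (he0 m).le)]
    refine ENNReal.ofReal_le_ofReal (add_le_add_left ?_ _)
    have h2 := mul_le_mul_of_nonneg_left (hgeom m) hc0
    refine h2.trans (le_of_eq ?_)
    rw [hc, chainingConst]
    ring
  have hlim : Tendsto (fun m => chainingConst γ * Real.sqrt A * Real.sqrt n * r ^ (1 - γ / 2)
      + n * e m) atTop (𝓝 (chainingConst γ * Real.sqrt A * Real.sqrt n * r ^ (1 - γ / 2)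
      + n * (r * 0))) :=
    ((((tendsto_pow_atTop_nhds_zero_of_lt_one (by norm_num) (by norm_num)).const_mul r).const_mul
      _).const_add _)
  rw [mul_zero, mul_zero, add_zero] at hlim
  exact ge_of_tendsto' ((ENNReal.continuous_ofReal.tendsto _).comp hlim) hall

end Chaining

/-! ## Symmetrization -/

section Symmetrization

variable {ι 𝒪 : Type*} [MeasurableSpace 𝒪] {P : Measure 𝒪} [IsProbabilityMeasure P] {n : ℕ}

theorem measurable_finset_sup {α : Type*} [MeasurableSpace α] {S : Finset ι} {f : ι → α → ℝ≥0∞}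
    (hf : ∀ i ∈ S, Measurable (f i)) : Measurable fun x => S.sup fun i => f i x := by
  simp only [Finset.sup_eq_iSup]
  exact Measurable.biSup _ S.countable_toSet hf

theorem integral_pi_comp_eval {g : 𝒪 → ℝ} (hg : Integrable g P) (i : Fin n) :
    Integrable (fun x : Fin n → 𝒪 => g (x i)) (Measure.pi fun _ => P) ∧
      ∫ x, g (x i) ∂(Measure.pi fun _ : Fin n => P) = ∫ o, g o ∂P := by
  have h := measurePreserving_eval (fun _ : Fin n => P) i
  refine ⟨h.integrable_comp_of_integrable hg, ?_⟩
  have h2 := integral_map h.measurable.aemeasurable (f := g) (h.map_eq ▸ hg.aestronglyMeasurable)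
  rw [h.map_eq] at h2
  exact h2.symm

/-- The mean of `g` is an average over an independent ghost sample `y`; Jensen moves the absolute
value inside. -/
theorem enorm_centered_le_lintegral {g : 𝒪 → ℝ} (hg : Integrable g P) (x : Fin n → 𝒪) :
    ‖∑ i, (g (x i) - ∫ o, g o ∂P)‖ₑ ≤
      ∫⁻ y, ‖∑ i, (g (x i) - g (y i))‖ₑ ∂(Measure.pi fun _ : Fin n => P) := by
  have h : ∑ i, (g (x i) - ∫ o, g o ∂P) =
      ∫ y, ∑ i, (g (x i) - g (y i)) ∂(Measure.pi fun _ : Fin n => P) := by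
    have hi : ∀ i ∈ Finset.univ, Integrable (fun y : Fin n → 𝒪 => g (x i) - g (y i))
        (Measure.pi fun _ => P) := fun i _ =>
      (integrable_const _).sub (integral_pi_comp_eval hg i).1
    rw [integral_finsetSum _ hi]
    refine Finset.sum_congr rfl fun i _ => ?_
    rw [integral_sub (integrable_const _) (integral_pi_comp_eval hg i).1,
      (integral_pi_comp_eval hg i).2]
    simp
  rw [h]
  exact enorm_integral_le_lintegral_enorm _

/-- Swapping the two copies in the coordinates of negative sign preserves the product measure and
puts that sign in front of the difference. The triangle inequality then separates the copies. -/
theorem lintegral_sup_diff_le {S : Finset ι} {g : ι → 𝒪 → ℝ} (hm : ∀ i ∈ S, Measurable (g i))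
    (s : Fin n → Bool) :
    ∫⁻ z, S.sup (fun i => ‖∑ j, (g i (z j).1 - g i (z j).2)‖ₑ)
        ∂(Measure.pi fun _ : Fin n => P.prod P) ≤
      2 * ∫⁻ x, S.sup (fun i => ‖∑ j, rademacherSign (s j) * g i (x j)‖ₑ)
        ∂(Measure.pi fun _ : Fin n => P) := by
  set f : Fin n → 𝒪 × 𝒪 → 𝒪 × 𝒪 := fun j => if s j then id else Prod.swap with hf
  have hfp : MeasurePreserving (fun (z : Fin n → 𝒪 × 𝒪) j => f j (z j))
      (Measure.pi fun _ => P.prod P) (Measure.pi fun _ => P.prod P) := by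
    refine measurePreserving_pi _ _ fun j => ?_
    rw [hf]
    by_cases h : s j
    · simp only [h, if_true]
      exact MeasurePreserving.id _
    · simp only [h]
      exact Measure.measurePreserving_swap
  have h1 : MeasurePreserving (fun (z : Fin n → 𝒪 × 𝒪) j => (z j).1)
      (Measure.pi fun _ => P.prod P) (Measure.pi fun _ => P) :=
    measurePreserving_pi _ _ fun _ => measurePreserving_fst
  have h2 : MeasurePreserving (fun (z : Fin n → 𝒪 × 𝒪) j => (z j).2)
      (Measure.pi fun _ => P.prod P) (Measure.pi fun _ => P) :=
    measurePreserving_pi _ _ fun _ => measurePreserving_snd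
  have hF : Measurable fun z : Fin n → 𝒪 × 𝒪 =>
      S.sup fun i => ‖∑ j, (g i (z j).1 - g i (z j).2)‖ₑ := by
    refine measurable_finset_sup fun i hi => ?_
    have := hm i hi
    fun_prop
  have hG : Measurable fun x : Fin n → 𝒪 =>
      S.sup fun i => ‖∑ j, rademacherSign (s j) * g i (x j)‖ₑ := by
    refine measurable_finset_sup fun i hi => ?_
    have := hm i hi
    fun_prop
  rw [← hfp.lintegral_comp hF]
  calc _ ≤ ∫⁻ z, (S.sup (fun i => ‖∑ j, rademacherSign (s j) * g i (z j).1‖ₑ) +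
          S.sup (fun i => ‖∑ j, rademacherSign (s j) * g i (z j).2‖ₑ))
            ∂(Measure.pi fun _ : Fin n => P.prod P) := by
        refine lintegral_mono fun z => le_trans (Finset.sup_mono_fun fun i _ => ?_)
          (finset_sup_add_le S _ _)
        have : ∑ j, (g i (f j (z j)).1 - g i (f j (z j)).2) =
            ∑ j, rademacherSign (s j) * g i (z j).1 - ∑ j, rademacherSign (s j) * g i (z j).2 := by
          rw [← Finset.sum_sub_distrib]
          refine Finset.sum_congr rfl fun j _ => ?_
          by_cases h : s j <;> simp [hf, h, rademacherSign]; ring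
        rw [this]
        exact enorm_sub_le
    _ = _ := by
        have h3 := h1.lintegral_comp hG
        have h4 := h2.lintegral_comp hG
        rw [two_mul]
        exact (lintegral_add_left (hG.comp h1.measurable) _).trans (congrArg₂ (· + ·) h3 h4)

/-- Symmetrization. -/
theorem lintegral_sup_centered_le {S : Finset ι} {g : ι → 𝒪 → ℝ}
    (hm : ∀ i ∈ S, Measurable (g i)) (hi : ∀ i ∈ S, Integrable (g i) P) :
    ∫⁻ x, S.sup (fun i => ‖∑ j, (g i (x j) - ∫ o, g i o ∂P)‖ₑ) ∂(Measure.pi fun _ : Fin n => P) ≤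
      2 * ∫⁻ x, rademacherMax S (fun i j => g i (x j)) ∂(Measure.pi fun _ : Fin n => P) := by
  have hF : Measurable fun w : (Fin n → 𝒪) × (Fin n → 𝒪) =>
      S.sup fun i => ‖∑ j, (g i (w.1 j) - g i (w.2 j))‖ₑ := by
    refine measurable_finset_sup fun i hi => ?_
    have := hm i hi
    fun_prop
  have hG : ∀ s : Fin n → Bool, Measurable fun x : Fin n → 𝒪 =>
      S.sup fun i => ‖∑ j, rademacherSign (s j) * g i (x j)‖ₑ := by
    intro s
    refine measurable_finset_sup fun i hi => ?_
    have := hm i hi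
    fun_prop
  have h1 : ∫⁻ x, S.sup (fun i => ‖∑ j, (g i (x j) - ∫ o, g i o ∂P)‖ₑ)
        ∂(Measure.pi fun _ : Fin n => P) ≤
      ∫⁻ z, S.sup (fun i => ‖∑ j, (g i (z j).1 - g i (z j).2)‖ₑ)
        ∂(Measure.pi fun _ : Fin n => P.prod P) := by
    have h := (measurePreserving_arrowProdEquivProdArrow 𝒪 𝒪 (Fin n) (fun _ => P)
      (fun _ => P)).lintegral_comp hF
    refine le_trans ?_ h.symm.le
    rw [lintegral_prod _ hF.aemeasurable]
    refine lintegral_mono fun x => Finset.sup_le fun i hiS => ?_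
    refine (enorm_centered_le_lintegral (hi i hiS) x).trans (lintegral_mono fun y => ?_)
    exact Finset.le_sup (f := fun i => ‖∑ j, (g i (x j) - g i (y j))‖ₑ) hiS
  refine h1.trans ?_
  -- The swapping bound holds for every sign vector, so the left side, which does not involve signs,
  -- is bounded by the average over all of them.
  rw [← inv_two_pow_mul_sum_const (n := n) (∫⁻ z, S.sup (fun i =>
    ‖∑ j, (g i (z j).1 - g i (z j).2)‖ₑ) ∂(Measure.pi fun _ : Fin n => P.prod P))]
  simp only [rademacherMax]
  rw [lintegral_const_mul _ (Finset.measurable_sum _ fun s _ => hG s),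
    lintegral_finsetSum _ fun s _ => hG s]
  refine (mul_le_mul' le_rfl (Finset.sum_le_sum fun s _ =>
    lintegral_sup_diff_le (P := P) hm s)).trans (le_of_eq ?_)
  rw [← Finset.mul_sum, mul_left_comm]

/-- Chebyshev's inequality for a centered sum. -/
theorem pi_measure_centered_ge_le {g : 𝒪 → ℝ} (hg : MemLp g 2 P) {t : ℝ} (ht : 0 < t) :
    (Measure.pi fun _ : Fin n => P) {x | t ≤ |∑ i, (g (x i) - ∫ o, g o ∂P)|} ≤
      ENNReal.ofReal (n * (∫ o, g o ^ 2 ∂P) / t ^ 2) := by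
  have hgi : Integrable g P := hg.integrable (by norm_num)
  have hmem : ∀ i : Fin n, MemLp (fun x : Fin n → 𝒪 => g (x i)) 2 (Measure.pi fun _ => P) :=
    fun i => hg.comp_measurePreserving (measurePreserving_eval (fun _ : Fin n => P) i)
  have hsum : MemLp (∑ i, fun x : Fin n → 𝒪 => g (x i)) 2 (Measure.pi fun _ => P) :=
    memLp_finsetSum' _ fun i _ => hmem i
  have hE : ∫ x, (∑ i, fun x : Fin n → 𝒪 => g (x i)) x ∂(Measure.pi fun _ : Fin n => P) =
      ∑ _i : Fin n, ∫ o, g o ∂P := by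
    simp only [Finset.sum_apply]
    rw [integral_finsetSum _ fun i _ => (integral_pi_comp_eval hgi i).1]
    exact Finset.sum_congr rfl fun i _ => (integral_pi_comp_eval hgi i).2
  have h := meas_ge_le_variance_div_sq hsum ht
  rw [hE, variance_sum_pi (X := fun _ => g) fun _ => hg] at h
  simp only [Finset.sum_apply, ← Finset.sum_sub_distrib] at h
  refine h.trans (ENNReal.ofReal_le_ofReal (div_le_div_of_nonneg_right ?_ (sq_nonneg t)))
  rw [Finset.sum_const, Finset.card_univ, Fintype.card_fin, nsmul_eq_mul]
  exact mul_le_mul_of_nonneg_left (variance_le_expectation_sq hg.aestronglyMeasurable)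
    (Nat.cast_nonneg n)

end Symmetrization

/-! ## A maximal inequality under uniform entropy -/

section MaximalInequality

variable {𝒪 : Type*}

/-- `L²`-nets with polynomial cardinality on the design `z`. -/
def HasNets {n : ℕ} (K γ : ℝ) (S : Set (𝒪 → ℝ)) (z : Fin n → 𝒪) : Prop :=
  ∀ ε : ℝ, 0 < ε → ε ≤ 1 → ∃ T : Finset (𝒪 → ℝ), (T.card : ℝ) ≤ Real.exp (K * ε ^ (-γ)) ∧
    ∀ g ∈ S, ∃ h ∈ T, ∑ i, (g (z i) - h (z i)) ^ 2 ≤ n * ε ^ 2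

/-- Nets are given for mesh at most 1; dividing by `R` reaches mesh up to `R`. The constant `K + 1`
instead of `K` keeps the entropy at least 1 at the first link, even when `K = 0`. -/
theorem HasNets.rescale {n : ℕ} {K γ R ε : ℝ} {S : Set (𝒪 → ℝ)} {z : Fin n → 𝒪}
    (h : HasNets K γ S z) (hR : 0 < R) (hε : 0 < ε) (hεR : ε ≤ R) :
    ∃ T : Finset (𝒪 → ℝ), (T.card : ℝ) ≤ Real.exp ((K + 1) * R ^ γ * ε ^ (-γ)) ∧
      ∀ g ∈ S, ∃ h ∈ T, ∑ i, (g (z i) - h (z i)) ^ 2 ≤ n * (ε / R) ^ 2 := by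
  obtain ⟨T, hT, hTS⟩ := h (ε / R) (div_pos hε hR) ((div_le_one hR).2 hεR)
  refine ⟨T, hT.trans (Real.exp_le_exp.2 ?_), hTS⟩
  have h1 : (ε / R) ^ (-γ) = R ^ γ * ε ^ (-γ) := by
    rw [Real.div_rpow hε.le hR.le, Real.rpow_neg hR.le, div_inv_eq_mul, mul_comm]
  have h2 : 0 ≤ R ^ γ * ε ^ (-γ) := by positivity
  rw [h1]
  linarith

theorem one_le_entropy_const {K γ r R : ℝ} (hK : 0 ≤ K) (hγ : 0 < γ) (hr : 0 < r) (hrR : r ≤ R) :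
    1 ≤ (K + 1) * R ^ γ * r ^ (-γ) := by
  have h1 : R ^ γ * r ^ (-γ) = (R / r) ^ γ := by
    rw [Real.div_rpow (hr.le.trans hrR) hr.le, Real.rpow_neg hr.le, div_eq_mul_inv]
  have h2 : 1 ≤ (R / r) ^ γ := Real.one_le_rpow ((one_le_div hr).2 hrR) hγ.le
  rw [mul_assoc, h1]
  nlinarith

theorem card_image_le_exp {α β : Type*} [DecidableEq β] {T : Finset α} (f : α → β) {c : ℝ}
    (h : (T.card : ℝ) ≤ c) : ((T.image f).card : ℝ) ≤ c :=
  le_trans (by exact_mod_cast Finset.card_image_le) h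

theorem rademacherMax_eval_le {n : ℕ} {K γ b r : ℝ} (hn : 0 < n) (hK : 0 ≤ K) (hγ0 : 0 < γ)
    (hγ : γ < 2) (hb : 1 ≤ b) {S : Finset (𝒪 → ℝ)} {z : Fin n → 𝒪} (hnet : HasNets K γ S z)
    (hr : 0 < r) (hrb : r ≤ 2 * b) (hS : ∀ g ∈ S, ∑ i, g (z i) ^ 2 ≤ n * r ^ 2) :
    rademacherMax S (fun g i => g (z i)) ≤ ENNReal.ofReal
      (chainingConst γ * Real.sqrt ((K + 1) * (2 * b) ^ γ) * Real.sqrt n * r ^ (1 - γ / 2)) := by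
  classical
  refine rademacherMax_le_of_entropy hn hr hγ0 hγ (one_le_entropy_const hK hγ0 hr hrb) hS
    fun ε hε hεr => ?_
  obtain ⟨T, hT, hTS⟩ := hnet.rescale (by linarith) hε (hεr.trans hrb)
  refine ⟨T.image fun h i => h (z i), card_image_le_exp _ hT, fun g hg => ?_⟩
  obtain ⟨h, hh, hgh⟩ := hTS g hg
  refine ⟨_, Finset.mem_image_of_mem _ hh, hgh.trans ?_⟩
  have : ε / (2 * b) ≤ ε := div_le_self hε.le (by linarith)
  have h0 : 0 ≤ ε / (2 * b) := by positivity
  gcongr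

/-- Net elements need not be bounded. Clipping to `[-b, b]` brings them no farther from `x`, and
squaring is `2b`-Lipschitz there; thus nets of a class yield nets of its squares. -/
theorem abs_sq_sub_sq_clip_le {b x y : ℝ} (hx : |x| ≤ b) :
    (x ^ 2 - (max (-b) (min b y)) ^ 2) ^ 2 ≤ (2 * b) ^ 2 * (x - y) ^ 2 := by
  have hb := (abs_nonneg x).trans hx
  have hx' := abs_le.1 hx
  set c := max (-b) (min b y) with hc
  have hcb : |c| ≤ b := abs_le.2 ⟨le_max_left _ _, max_le (by linarith) (min_le_left _ _)⟩
  have h1 : (x - c) ^ 2 ≤ (x - y) ^ 2 := by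
    rw [sq_le_sq, hc]
    rcases le_total y b with h | h
    · rw [min_eq_right h]
      rcases le_total (-b) y with h' | h'
      · rw [max_eq_right h']
      · rw [max_eq_left h', abs_of_nonneg (by linarith), abs_of_nonneg (by linarith)]
        linarith
    · rw [min_eq_left h, max_eq_right (by linarith), abs_of_nonpos (by linarith),
        abs_of_nonpos (by linarith)]
      linarith
  have h2 : (x + c) ^ 2 ≤ (2 * b) ^ 2 := by
    rw [sq_le_sq, abs_of_nonneg (show 0 ≤ 2 * b by linarith)]
    exact (abs_add_le x c).trans (by linarith)
  calc (x ^ 2 - c ^ 2) ^ 2 = (x + c) ^ 2 * (x - c) ^ 2 := by ring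
    _ ≤ (2 * b) ^ 2 * (x - y) ^ 2 := mul_le_mul h2 h1 (sq_nonneg _) (sq_nonneg _)

theorem rademacherMax_sq_eval_le {n : ℕ} {K γ b : ℝ} (hn : 0 < n) (hK : 0 ≤ K) (hγ0 : 0 < γ)
    (hγ : γ < 2) (hb : 1 ≤ b) {S : Finset (𝒪 → ℝ)} {z : Fin n → 𝒪} (hnet : HasNets K γ S z)
    (hS : ∀ g ∈ S, ∀ o, |g o| ≤ b) :
    rademacherMax S (fun g i => g (z i) ^ 2) ≤ ENNReal.ofReal
      (chainingConst γ * Real.sqrt ((K + 1) * (2 * b ^ 2) ^ γ) * Real.sqrt n *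
        (2 * b ^ 2) ^ (1 - γ / 2)) := by
  classical
  have hR : 0 < 2 * b ^ 2 := by positivity
  refine rademacherMax_le_of_entropy hn hR hγ0 hγ (one_le_entropy_const hK hγ0 hR le_rfl)
    (fun g hg => ?_) fun ε hε hεr => ?_
  · have h1 : ∀ i ∈ Finset.univ, (g (z i) ^ 2) ^ 2 ≤ (2 * b ^ 2) ^ 2 := fun i _ => by
      have h2 : g (z i) ^ 2 ≤ b ^ 2 := sq_le_sq' (by linarith [(abs_le.1 (hS g hg (z i))).1])
        (abs_le.1 (hS g hg (z i))).2
      exact pow_le_pow_left₀ (sq_nonneg _) (by linarith [sq_nonneg b]) 2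
    refine (Finset.sum_le_sum h1).trans ?_
    simp
  · obtain ⟨T, hT, hTS⟩ := hnet.rescale hR hε hεr
    refine ⟨T.image fun h i => (max (-b) (min b (h (z i)))) ^ 2, card_image_le_exp _ hT,
      fun g hg => ?_⟩
    obtain ⟨h, hh, hgh⟩ := hTS g hg
    refine ⟨_, Finset.mem_image_of_mem _ hh, ?_⟩
    refine (Finset.sum_le_sum fun i _ =>
      abs_sq_sub_sq_clip_le (y := h (z i)) (hS g hg (z i))).trans ?_
    rw [← Finset.mul_sum]
    refine (mul_le_mul_of_nonneg_left hgh (sq_nonneg _)).trans ?_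
    have h1 : (2 * b) ^ 2 * (n * (ε / (2 * b ^ 2)) ^ 2) = n * ((ε / b) ^ 2) := by
      have : b ≠ 0 := by linarith
      field_simp
    rw [h1]
    have : ε / b ≤ ε := div_le_self hε.le hb
    have h0 : 0 ≤ ε / b := by positivity
    gcongr

/-- Bernoulli's inequality at `c`, with slope `p` relaxed to 1. It makes a power of a random radius
affine in the squared radius, so that only its mean is needed. -/
theorem add_rpow_le_of_le_one {x c p : ℝ} (hx : 0 ≤ x) (hc : 0 < c) (hp0 : 0 ≤ p) (hp1 : p ≤ 1) :
    (x + c) ^ p ≤ c ^ p + c ^ (p - 1) * x := by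
  have h1 := rpow_one_add_le_one_add_mul_self (s := x / c) (p := p)
    (by have : 0 ≤ x / c := by positivity
        linarith) hp0 hp1
  have h2 : x + c = c * (1 + x / c) := by field_simp; ring
  have h3 : 0 ≤ x / c := by positivity
  have h4 : (1 + x / c) ^ p ≤ 1 + x / c := h1.trans (by nlinarith)
  rw [h2, Real.mul_rpow hc.le (by linarith), Real.rpow_sub_one hc.ne']
  calc c ^ p * (1 + x / c) ^ p ≤ c ^ p * (1 + x / c) :=
        mul_le_mul_of_nonneg_left h4 (Real.rpow_nonneg hc.le _)
    _ = c ^ p + c ^ p / c * x := by ring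

variable [MeasurableSpace 𝒪] {P : Measure 𝒪} [IsProbabilityMeasure P]

/-- The mean of the largest empirical second moment. -/
theorem lintegral_sup_empirical_sq_le {n : ℕ} {K γ b c : ℝ} (hn : 0 < n) (hK : 0 ≤ K)
    (hγ0 : 0 < γ) (hγ : γ < 2) (hb : 1 ≤ b) {S : Finset (𝒪 → ℝ)}
    (hm : ∀ g ∈ S, Measurable g) (hS : ∀ g ∈ S, ∀ o, |g o| ≤ b)
    (hnet : ∀ z : Fin n → 𝒪, HasNets K γ S z) (hc : 0 < c) (hcn : (Real.sqrt n)⁻¹ ≤ c)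
    (hSc : ∀ g ∈ S, ∫ o, g o ^ 2 ∂P ≤ c) :
    ∫⁻ x, S.sup (fun g => ENNReal.ofReal ((n : ℝ)⁻¹ * ∑ i, g (x i) ^ 2))
        ∂(Measure.pi fun _ : Fin n => P) ≤
      ENNReal.ofReal ((1 + 2 * (chainingConst γ * Real.sqrt ((K + 1) * (2 * b ^ 2) ^ γ) *
        (2 * b ^ 2) ^ (1 - γ / 2))) * c) := by
  have hn' : (0 : ℝ) < n := by exact_mod_cast hn
  set D := chainingConst γ * Real.sqrt ((K + 1) * (2 * b ^ 2) ^ γ) * (2 * b ^ 2) ^ (1 - γ / 2)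
    with hD
  have hD0 : 0 ≤ D := by have := chainingConst_pos hγ; positivity
  have hsym := lintegral_sup_centered_le (P := P) (n := n) (S := S) (g := fun g o => g o ^ 2)
    (fun g hg => (hm g hg).pow_const 2) (fun g hg => by
      refine Integrable.of_bound ((hm g hg).pow_const 2).aestronglyMeasurable (b ^ 2)
        (ae_of_all _ fun o => ?_)
      rw [Real.norm_eq_abs, abs_pow]
      exact pow_le_pow_left₀ (abs_nonneg _) (hS g hg o) 2)
  have hrad : ∀ x : Fin n → 𝒪, rademacherMax S (fun g i => g (x i) ^ 2) ≤
      ENNReal.ofReal (D * Real.sqrt n) := fun x =>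
    (rademacherMax_sq_eval_le hn hK hγ0 hγ hb (hnet x) hS).trans
      (ENNReal.ofReal_le_ofReal (le_of_eq (by rw [hD]; ring)))
  have hsym' := hsym.trans (mul_le_mul' le_rfl (lintegral_mono hrad))
  rw [lintegral_const, measure_univ, mul_one] at hsym'
  -- Empirical second moment equals true second moment plus a centered average of squares; the
  -- centered part has mean of order `n^{-1/2} ≤ c`.
  have hpt : ∀ x : Fin n → 𝒪,
      S.sup (fun g => ENNReal.ofReal ((n : ℝ)⁻¹ * ∑ i, g (x i) ^ 2)) ≤
        ENNReal.ofReal c + ENNReal.ofReal (n : ℝ)⁻¹ *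
          S.sup (fun g => ‖∑ j, (g (x j) ^ 2 - ∫ o, g o ^ 2 ∂P)‖ₑ) := by
    intro x
    refine Finset.sup_le fun g hg => ?_
    refine le_trans ?_ (add_le_add le_rfl (mul_le_mul' le_rfl (Finset.le_sup (f := fun g =>
      ‖∑ j, (g (x j) ^ 2 - ∫ o, g o ^ 2 ∂P)‖ₑ) hg)))
    rw [Real.enorm_eq_ofReal_abs, ← ENNReal.ofReal_mul (by positivity),
      ← ENNReal.ofReal_add hc.le (by positivity)]
    refine ENNReal.ofReal_le_ofReal ?_
    have h1 : (n : ℝ)⁻¹ * ∑ i, g (x i) ^ 2 = ∫ o, g o ^ 2 ∂P +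
        (n : ℝ)⁻¹ * ∑ j, (g (x j) ^ 2 - ∫ o, g o ^ 2 ∂P) := by
      rw [Finset.sum_sub_distrib]
      simp only [Finset.sum_const, Finset.card_univ, Fintype.card_fin, nsmul_eq_mul]
      field_simp
      ring
    rw [h1]
    exact add_le_add (hSc g hg) (mul_le_mul_of_nonneg_left (le_abs_self _) (by positivity))
  refine (lintegral_mono hpt).trans ?_
  rw [lintegral_add_left measurable_const, lintegral_const, measure_univ, mul_one,
    lintegral_const_mul']
  swap
  · exact ENNReal.ofReal_ne_top
  refine (add_le_add le_rfl (mul_le_mul' le_rfl hsym')).trans ?_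
  rw [show (2 : ℝ≥0∞) = ENNReal.ofReal 2 by simp, ← ENNReal.ofReal_mul (by norm_num),
    ← ENNReal.ofReal_mul (by positivity), ← ENNReal.ofReal_add hc.le (by positivity)]
  refine ENNReal.ofReal_le_ofReal ?_
  have h2 : (n : ℝ)⁻¹ * (2 * (D * Real.sqrt n)) = 2 * D * (Real.sqrt n)⁻¹ := by
    have h3 : Real.sqrt n ≠ 0 := (Real.sqrt_pos.2 hn').ne'
    have h4 : (n : ℝ) = Real.sqrt n * Real.sqrt n := (Real.mul_self_sqrt hn'.le).symm
    rw [h4, Real.sqrt_mul_self (Real.sqrt_nonneg _)]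
    field_simp
  rw [h2]
  have := mul_le_mul_of_nonneg_left hcn (show 0 ≤ 2 * D by positivity)
  linarith

/-- A maximal inequality for the empirical process over a uniformly bounded class with polynomial
uniform entropy and small second moments; the constant depends on `K`, `γ` and `b` only. -/
theorem exists_lintegral_sup_centered_le (P : Measure 𝒪) [IsProbabilityMeasure P] {K γ b : ℝ}
    (hK : 0 ≤ K) (hγ0 : 0 < γ) (hγ : γ < 2) (hb : 1 ≤ b) :
    ∃ D : ℝ, 0 ≤ D ∧ ∀ (n : ℕ) (S : Finset (𝒪 → ℝ)) (c : ℝ), 0 < n →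
      (∀ g ∈ S, Measurable g) → (∀ g ∈ S, ∀ o, |g o| ≤ b) →
      (∀ z : Fin n → 𝒪, HasNets K γ S z) → 0 < c → c ≤ 2 → (Real.sqrt n)⁻¹ ≤ c →
      (∀ g ∈ S, ∫ o, g o ^ 2 ∂P ≤ c) →
      ∫⁻ x, S.sup (fun g => ‖∑ i, (g (x i) - ∫ o, g o ∂P)‖ₑ) ∂(Measure.pi fun _ : Fin n => P) ≤
        ENNReal.ofReal (D * Real.sqrt n * c ^ ((1 - γ / 2) / 2)) := by
  set D₁ := chainingConst γ * Real.sqrt ((K + 1) * (2 * b) ^ γ) with hD₁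
  set D₂ := chainingConst γ * Real.sqrt ((K + 1) * (2 * b ^ 2) ^ γ) * (2 * b ^ 2) ^ (1 - γ / 2)
    with hD₂
  have hch := chainingConst_pos hγ
  have hD₁0 : 0 ≤ D₁ := by positivity
  have hD₂0 : 0 ≤ D₂ := by positivity
  refine ⟨2 * (D₁ * (2 + 2 * D₂)), by positivity,
    fun n S c hn hm hS hnet hc hc2 hcn hSc => ?_⟩
  have hn' : (0 : ℝ) < n := by exact_mod_cast hn
  set p := (1 - γ / 2) / 2 with hp
  have hp0 : 0 ≤ p := by rw [hp]; linarith
  have hp1 : p ≤ 1 := by rw [hp]; linarith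
  refine (lintegral_sup_centered_le hm fun g hg =>
    Integrable.of_bound (hm g hg).aestronglyMeasurable b (ae_of_all _ (hS g hg))).trans ?_
  set M : (Fin n → 𝒪) → ℝ≥0∞ := fun x =>
    S.sup (fun g => ENNReal.ofReal ((n : ℝ)⁻¹ * ∑ i, g (x i) ^ 2)) with hM
  -- Conditionally on the sample, chaining starts at the random radius `√(M x + c)`. The summand `c`
  -- keeps it positive and is the point of linearization.
  have hpt : ∀ x : Fin n → 𝒪, rademacherMax S (fun g i => g (x i)) ≤
      ENNReal.ofReal (D₁ * Real.sqrt n) *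
        (ENNReal.ofReal (c ^ p) + ENNReal.ofReal (c ^ (p - 1)) * M x) := by
    intro x
    have hMb : M x ≤ ENNReal.ofReal (b ^ 2) := by
      refine Finset.sup_le fun g hg => ENNReal.ofReal_le_ofReal ?_
      rw [inv_mul_le_iff₀ hn']
      refine (Finset.sum_le_sum fun i _ => sq_le_sq' (by linarith [(abs_le.1 (hS g hg (x i))).1])
        (abs_le.1 (hS g hg (x i))).2).trans ?_
      simp
    have hMtop : M x ≠ ⊤ := ne_top_of_le_ne_top ENNReal.ofReal_ne_top hMb
    set y := (M x).toReal with hy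
    have hy0 : 0 ≤ y := ENNReal.toReal_nonneg
    have hyb : y ≤ b ^ 2 := ENNReal.toReal_le_of_le_ofReal (sq_nonneg b) hMb
    have hMy : M x = ENNReal.ofReal y := (ENNReal.ofReal_toReal hMtop).symm
    have hr : 0 < Real.sqrt (y + c) := Real.sqrt_pos.2 (by linarith)
    -- Here `c ≤ 2` and `b ≥ 1` enter: `b² + 2 ≤ 4b²`.
    have hrb : Real.sqrt (y + c) ≤ 2 * b := Real.sqrt_le_iff.2 ⟨by linarith, by nlinarith⟩
    refine (rademacherMax_eval_le hn hK hγ0 hγ hb (hnet x) hr hrb fun g hg => ?_).trans ?_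
    · rw [Real.sq_sqrt (by linarith)]
      have h1 : ENNReal.ofReal ((n : ℝ)⁻¹ * ∑ i, g (x i) ^ 2) ≤ ENNReal.ofReal y := by
        rw [← hMy]
        exact Finset.le_sup (f := fun g : 𝒪 → ℝ =>
          ENNReal.ofReal ((n : ℝ)⁻¹ * ∑ i, g (x i) ^ 2)) hg
      have h2 := (ENNReal.ofReal_le_ofReal_iff hy0).1 h1
      rw [inv_mul_le_iff₀ hn'] at h2
      have := mul_pos hn' hc
      linarith
    · rw [hMy, ← ENNReal.ofReal_mul (by positivity), ← ENNReal.ofReal_add (by positivity)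
        (by positivity), ← ENNReal.ofReal_mul (by positivity)]
      refine ENNReal.ofReal_le_ofReal (mul_le_mul_of_nonneg_left ?_ (by positivity))
      have h1 : Real.sqrt (y + c) ^ (1 - γ / 2) = (y + c) ^ p := by
        rw [Real.sqrt_eq_rpow, ← Real.rpow_mul (by linarith)]
        congr 1
        rw [hp]; ring
      rw [h1]
      exact add_rpow_le_of_le_one hy0 hc hp0 hp1
  have hmean := lintegral_sup_empirical_sq_le hn hK hγ0 hγ hb hm hS hnet hc hcn hSc
  rw [← hD₂] at hmean
  have hint : ∫⁻ x, rademacherMax S (fun g i => g (x i)) ∂(Measure.pi fun _ : Fin n => P) ≤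
      ENNReal.ofReal (D₁ * Real.sqrt n * ((2 + 2 * D₂) * c ^ p)) := by
    refine (lintegral_mono hpt).trans ?_
    rw [lintegral_const_mul' _ _ ENNReal.ofReal_ne_top, lintegral_add_left measurable_const,
      lintegral_const, measure_univ, mul_one, lintegral_const_mul' _ _ ENNReal.ofReal_ne_top]
    refine (mul_le_mul' le_rfl (add_le_add le_rfl (mul_le_mul' le_rfl hmean))).trans ?_
    rw [← ENNReal.ofReal_mul (by positivity), ← ENNReal.ofReal_add (by positivity)
      (by positivity), ← ENNReal.ofReal_mul (by positivity)]
    refine ENNReal.ofReal_le_ofReal (le_of_eq ?_)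
    rw [Real.rpow_sub_one hc.ne']
    field_simp
    ring
  refine (mul_le_mul' le_rfl hint).trans ?_
  rw [show (2 : ℝ≥0∞) = ENNReal.ofReal 2 by simp, ← ENNReal.ofReal_mul (by norm_num)]
  exact ENNReal.ofReal_le_ofReal (le_of_eq (by ring))

end MaximalInequality

/-! ## Asymptotic equicontinuity of the empirical process -/

section Covering

variable {𝒪 : Type*} {ρ : (𝒪 → ℝ) → (𝒪 → ℝ) → ℝ≥0∞} {K γ : ℝ} {F : Set (𝒪 → ℝ)}

theorem EntropyBound.nonneg (h : EntropyBound ρ K γ F) : 0 ≤ K := by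
  have h1 := (h 1 one_pos le_rfl).2
  rw [Real.one_rpow, mul_one] at h1
  exact (Real.log_natCast_nonneg _).trans h1

theorem EntropyBound.exists_net (h : EntropyBound ρ K γ F) {ε : ℝ} (hε : 0 < ε) (hε1 : ε ≤ 1) :
    ∃ T : Finset (𝒪 → ℝ), (T.card : ℝ) ≤ Real.exp (K * ε ^ (-γ)) ∧
      ∀ f ∈ F, ∃ g ∈ T, ρ f g ≤ ENNReal.ofReal ε := by
  obtain ⟨h1, h2⟩ := h ε hε hε1
  obtain ⟨T, hT⟩ := ENat.exists_eq_iInf fun T : Finset (𝒪 → ℝ) =>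
    ⨅ (_ : ∀ f ∈ F, ∃ g ∈ T, ρ f g ≤ ENNReal.ofReal ε), (T.card : ℕ∞)
  have hT' : (⨅ (_ : ∀ f ∈ F, ∃ g ∈ T, ρ f g ≤ ENNReal.ofReal ε), (T.card : ℕ∞)) =
      coverNumber ρ ε F := hT
  by_cases hp : ∀ f ∈ F, ∃ g ∈ T, ρ f g ≤ ENNReal.ofReal ε
  · refine ⟨T, ?_, hp⟩
    rw [iInf_pos hp] at hT'
    rw [← hT', ENat.toNat_natCast] at h2
    -- An empty net is treated apart, because `Real.log 0 = 0` says nothing about it.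
    rcases Nat.eq_zero_or_pos T.card with h0 | h0
    · rw [h0, Nat.cast_zero]
      exact (Real.exp_pos _).le
    · exact (Real.log_le_iff_le_exp (by exact_mod_cast h0)).1 h2
  · rw [iInf_neg hp] at hT'
    exact absurd hT'.symm h1

theorem supDist_le_iff {f g : 𝒪 → ℝ} {ε : ℝ} (hε : 0 ≤ ε) :
    supDist f g ≤ ENNReal.ofReal ε ↔ ∀ o, |f o - g o| ≤ ε := by
  simp only [supDist, iSup_le_iff, ENNReal.ofReal_le_ofReal_iff hε]

theorem sum_sq_le_of_l2Dist_le {m : ℕ} (hm : 0 < m) {z : Fin m → 𝒪} {f g : 𝒪 → ℝ} {ε : ℝ}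
    (hε : 0 ≤ ε) (h : l2Dist z f g ≤ ENNReal.ofReal ε) :
    ∑ i, (f (z i) - g (z i)) ^ 2 ≤ m * ε ^ 2 := by
  have hm' : (0 : ℝ) < m := by exact_mod_cast hm
  rw [l2Dist, ENNReal.ofReal_le_ofReal_iff hε, Real.sqrt_le_left hε, inv_mul_le_iff₀ hm'] at h
  exact h

theorem EntropyBound.hasNets {m : ℕ} (hm : 0 < m) {z : Fin m → 𝒪}
    (h : EntropyBound (l2Dist z) K γ F) : HasNets K γ F z := by
  intro ε hε hε1
  obtain ⟨T, hT, hTF⟩ := h.exists_net hε hε1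
  refine ⟨T, hT, fun g hg => ?_⟩
  obtain ⟨g', hg', hgg'⟩ := hTF g hg
  exact ⟨g', hg', sum_sq_le_of_l2Dist_le hm hε.le hgg'⟩

theorem HasNets.mono {m : ℕ} {S : Set (𝒪 → ℝ)} {z : Fin m → 𝒪} (h : HasNets K γ F z)
    (hS : S ⊆ F) : HasNets K γ S z := fun ε hε hε1 => by
  obtain ⟨T, hT, hTF⟩ := h ε hε hε1
  exact ⟨T, hT, fun g hg => hTF g (hS hg)⟩

/-- Covering a subclass in supremum norm by its own elements. -/
theorem EntropyBound.exists_internal_net (h : EntropyBound supDist K γ F) {S : Set (𝒪 → ℝ)}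
    (hS : S ⊆ F) {ε : ℝ} (hε : 0 < ε) (hε1 : ε ≤ 1) :
    ∃ T : Finset (𝒪 → ℝ), (T.card : ℝ) ≤ Real.exp (K * ε ^ (-γ)) ∧ (∀ g ∈ T, g ∈ S) ∧
      ∀ f ∈ S, ∃ g ∈ T, ∀ o, |f o - g o| ≤ 2 * ε := by
  classical
  obtain ⟨T, hT, hTF⟩ := h.exists_net hε hε1
  -- The tautology is there for `choose!`: every ball that meets `S` gets a representative from `S`.
  -- Recentering there doubles the radius.
  have hc : ∀ t : 𝒪 → ℝ, (∃ g ∈ S, supDist g t ≤ ENNReal.ofReal ε) →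
      ∃ g ∈ S, supDist g t ≤ ENNReal.ofReal ε := fun _ h => h
  choose! φ hφS hφ using hc
  set T' := T.filter fun t => ∃ g ∈ S, supDist g t ≤ ENNReal.ofReal ε with hT'
  refine ⟨T'.image φ, card_image_le_exp _ (le_trans ?_ hT), fun g hg => ?_, fun f hf => ?_⟩
  · exact_mod_cast Finset.card_filter_le _ _
  · obtain ⟨t, ht, rfl⟩ := Finset.mem_image.1 hg
    exact hφS t (Finset.mem_filter.1 ht).2
  · obtain ⟨t, ht, hft⟩ := hTF f (hS hf)
    have hex : ∃ g ∈ S, supDist g t ≤ ENNReal.ofReal ε := ⟨f, hf, hft⟩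
    refine ⟨φ t, Finset.mem_image_of_mem _ (Finset.mem_filter.2 ⟨ht, hex⟩), fun o => ?_⟩
    have h1 := (supDist_le_iff hε.le).1 hft o
    have h2 := (supDist_le_iff hε.le).1 (hφ t hex) o
    rw [abs_le] at h1 h2 ⊢
    constructor <;> linarith

end Covering

/-! ### Tail bounds and equicontinuity of the centered empirical sums. -/

section Equicontinuity

variable {𝒪 Ω : Type*} [MeasurableSpace 𝒪] {P₀ : Measure 𝒪} {O : ℕ → Ω → 𝒪}

/-- `n (P_n - P₀) g`. -/
noncomputable def empDeviation (P₀ : Measure 𝒪) (O : ℕ → Ω → 𝒪) (n : ℕ) (ω : Ω) (g : 𝒪 → ℝ) : ℝ :=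
  ∑ i ∈ Finset.range n, (g (O i ω) - ∫ o, g o ∂P₀)

theorem empDeviation_eq_sum_fin (n : ℕ) (ω : Ω) (g : 𝒪 → ℝ) :
    empDeviation P₀ O n ω g = ∑ i : Fin n, (g (O i ω) - ∫ o, g o ∂P₀) :=
  Finset.sum_range _

theorem empDeviation_add {g h : 𝒪 → ℝ} (hg : Integrable g P₀) (hh : Integrable h P₀) (n : ℕ)
    (ω : Ω) : empDeviation P₀ O n ω (g + h) =
      empDeviation P₀ O n ω g + empDeviation P₀ O n ω h := by
  simp only [empDeviation, ← Finset.sum_add_distrib, Pi.add_apply]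
  rw [integral_add hg hh]
  exact Finset.sum_congr rfl fun i _ => by ring

theorem abs_empDeviation_le [IsProbabilityMeasure P₀] {g : 𝒪 → ℝ} {ε : ℝ} (hg : ∀ o, |g o| ≤ ε) (n : ℕ) (ω : Ω) :
    |empDeviation P₀ O n ω g| ≤ n * (2 * ε) := by
  have h1 : |∫ o, g o ∂P₀| ≤ ε := by
    have := norm_integral_le_of_norm_le_const (μ := P₀) (f := g) (C := ε) (ae_of_all _ hg)
    simpa using this
  refine (Finset.abs_sum_le_sum_abs _ _).trans ?_
  refine (Finset.sum_le_sum (g := fun _ => 2 * ε) fun i _ => ?_).trans (by simp)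
  exact (abs_sub _ _).trans (by linarith [hg (O i ω)])

variable [MeasurableSpace Ω] {μ : Measure Ω}

theorem measurePreserving_sample (hO : ∀ i, Measurable (O i)) (hO_indep : iIndepFun O μ)
    (hO_law : ∀ i, μ.map (O i) = P₀) (n : ℕ) :
    MeasurePreserving (fun ω (i : Fin n) => O i ω) μ (Measure.pi fun _ => P₀) := by
  refine ⟨measurable_pi_lambda _ fun i => hO i, ?_⟩
  have h := iIndepFun.map_fun_eq_pi_map (f := fun i : Fin n => O i)
    (fun i => (hO i).aemeasurable) (hO_indep.precomp Fin.val_injective)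
  rw [h]
  simp only [hO_law]

variable [IsProbabilityMeasure P₀]

theorem measure_empDeviation_ge_le (hO : ∀ i, Measurable (O i)) (hO_indep : iIndepFun O μ)
    (hO_law : ∀ i, μ.map (O i) = P₀) {n : ℕ} (hn : 0 < n) {g : 𝒪 → ℝ} (hgm : Measurable g)
    (hg : MemLp g 2 P₀) {c t : ℝ} (hc : ∫ o, g o ^ 2 ∂P₀ ≤ c) (ht : 0 < t) :
    μ {ω | t * Real.sqrt n ≤ |empDeviation P₀ O n ω g|} ≤ ENNReal.ofReal (c / t ^ 2) := by
  have hn' : (0 : ℝ) < n := by exact_mod_cast hn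
  have hZ := measurePreserving_sample hO hO_indep hO_law n
  have hmeas : MeasurableSet {x : Fin n → 𝒪 | t * Real.sqrt n ≤ |∑ i, (g (x i) - ∫ o, g o ∂P₀)|} :=
    measurableSet_le measurable_const (by fun_prop)
  have h := hZ.measure_preimage hmeas.nullMeasurableSet
  have h2 := pi_measure_centered_ge_le (n := n) hg
    (show 0 < t * Real.sqrt n from mul_pos ht (Real.sqrt_pos.2 hn'))
  rw [← h] at h2
  simp only [empDeviation_eq_sum_fin]
  refine h2.trans (ENNReal.ofReal_le_ofReal ?_)
  rw [mul_pow, Real.sq_sqrt hn'.le, mul_comm (t ^ 2), mul_div_mul_left _ _ hn'.ne']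
  exact div_le_div_of_nonneg_right hc (sq_nonneg t)

/-- The tail bound for finite classes with polynomial uniform entropy. -/
theorem exists_measure_empDeviation_le (hO : ∀ i, Measurable (O i)) (hO_indep : iIndepFun O μ)
    (hO_law : ∀ i, μ.map (O i) = P₀) {K γ b : ℝ} (hK : 0 ≤ K) (hγ0 : 0 < γ) (hγ : γ < 2)
    (hb : 1 ≤ b) :
    ∃ D : ℝ, 0 ≤ D ∧ ∀ (n : ℕ) (S : Finset (𝒪 → ℝ)) (c t : ℝ), 0 < n →
      (∀ g ∈ S, Measurable g) → (∀ g ∈ S, ∀ o, |g o| ≤ b) →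
      (∀ z : Fin n → 𝒪, HasNets K γ S z) → 0 < c → c ≤ 2 → (Real.sqrt n)⁻¹ ≤ c →
      (∀ g ∈ S, ∫ o, g o ^ 2 ∂P₀ ≤ c) → 0 < t →
      μ {ω | ∃ g ∈ S, t * Real.sqrt n ≤ |empDeviation P₀ O n ω g|} ≤
        ENNReal.ofReal (D * c ^ ((1 - γ / 2) / 2) / t) := by
  obtain ⟨D, hD, h⟩ := exists_lintegral_sup_centered_le P₀ hK hγ0 hγ hb
  refine ⟨D, hD, fun n S c t hn hm hS hnet hc hc2 hcn hSc ht => ?_⟩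
  have hn' : (0 : ℝ) < n := by exact_mod_cast hn
  have hsn : 0 < Real.sqrt n := Real.sqrt_pos.2 hn'
  have hZ := measurePreserving_sample hO hO_indep hO_law n
  have hF : Measurable fun x : Fin n → 𝒪 => S.sup fun g => ‖∑ i, (g (x i) - ∫ o, g o ∂P₀)‖ₑ := by
    refine measurable_finset_sup fun g hg => ?_
    have := hm g hg
    fun_prop
  have h1 := h n S c hn hm hS hnet hc hc2 hcn hSc
  have h2 := meas_ge_le_lintegral_div (μ := Measure.pi fun _ : Fin n => P₀) hF.aemeasurable
    (ε := ENNReal.ofReal (t * Real.sqrt n)) (by simp [mul_pos ht hsn]) ENNReal.ofReal_ne_top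
  have h3 := hZ.measure_preimage (measurableSet_le (measurable_const
    (a := ENNReal.ofReal (t * Real.sqrt n))) hF).nullMeasurableSet
  rw [← h3] at h2
  refine (measure_mono ?_).trans (h2.trans ((ENNReal.div_le_div_right h1 _).trans ?_))
  · rintro ω ⟨g, hg, hgt⟩
    refine le_trans ?_ (Finset.le_sup (f := fun g : 𝒪 → ℝ =>
      ‖∑ i : Fin n, (g (O i ω) - ∫ o, g o ∂P₀)‖ₑ) hg)
    rw [Real.enorm_eq_ofReal_abs, ← empDeviation_eq_sum_fin]
    exact ENNReal.ofReal_le_ofReal hgt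
  · rw [← ENNReal.ofReal_div_of_pos (mul_pos ht hsn)]
    refine ENNReal.ofReal_le_ofReal (le_of_eq ?_)
    field_simp

theorem exists_small_rpow {p a : ℝ} (hp : 0 < p) (ha : 0 < a) (D : ℝ) :
    ∀ᶠ c : ℝ in 𝓝[>] 0, D * c ^ p ≤ a := by
  have h : Tendsto (fun c : ℝ => D * c ^ p) (𝓝 0) (𝓝 (D * 0 ^ p)) :=
    ((Real.continuousAt_rpow_const 0 p (Or.inr hp.le)).tendsto).const_mul D
  rw [Real.zero_rpow hp.ne', mul_zero] at h
  exact ((h.eventually_lt_const ha).mono fun _ => le_of_lt).filter_mono nhdsWithin_le_nhds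

theorem tendsto_inv_sqrt_natCast : Tendsto (fun n : ℕ => (Real.sqrt n)⁻¹) atTop (𝓝 0) :=
  tendsto_inv_atTop_zero.comp (Real.tendsto_sqrt_atTop.comp tendsto_natCast_atTop_atTop)

/-- Asymptotic equicontinuity under uniform entropy of bounded, pointwise measurable classes. -/
theorem equicontinuity_of_uniform_entropy [IsProbabilityMeasure μ] (hO : ∀ i, Measurable (O i)) (hO_indep : iIndepFun O μ)
    (hO_law : ∀ i, μ.map (O i) = P₀) {K γ b : ℝ} (hγ0 : 0 < γ) (hγ : γ < 2)
    {F : ℕ → Set (𝒪 → ℝ)} (hpm : ∀ n, PointwiseMeasurable (F n))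
    (hb : ∀ n, ∀ f ∈ F n, ∀ o, |f o| ≤ b)
    (hent : ∀ n, ∀ m : ℕ, 0 < m → ∀ z : Fin m → 𝒪, EntropyBound (l2Dist z) K γ (F n))
    {t δ : ℝ} (ht : 0 < t) (hδ : 0 < δ) :
    ∃ c : ℝ, 0 < c ∧ ∀ᶠ n : ℕ in atTop,
      μ {ω | ∃ g ∈ F n, ∫ o, g o ^ 2 ∂P₀ ≤ c ∧ t * Real.sqrt n < |empDeviation P₀ O n ω g|} ≤
        ENNReal.ofReal δ := by
  classical
  obtain ⟨ω₀⟩ : Nonempty Ω := nonempty_of_isProbabilityMeasure μ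
  have hK : 0 ≤ K := (hent 0 1 one_pos fun _ => O 0 ω₀).nonneg
  obtain ⟨D, hD, htail⟩ := exists_measure_empDeviation_le (P₀ := P₀) hO hO_indep hO_law hK hγ0 hγ
    (le_max_left 1 b)
  obtain ⟨c, ⟨hcD, hc2⟩, hc⟩ := (((exists_small_rpow (p := (1 - γ / 2) / 2) (by linarith)
    (mul_pos hδ ht) D).and (Ioo_mem_nhdsGT (show (0 : ℝ) < 2 by norm_num))).and
    self_mem_nhdsWithin).exists
  replace hc : 0 < c := hc
  -- The gap between `c / 2` and `c`, like the strict inequality for the deviation, lets both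
  -- conditions pass to an approximating member of the countable subclass.
  refine ⟨c / 2, by linarith, ?_⟩
  filter_upwards [tendsto_inv_sqrt_natCast.eventually_le_const hc, eventually_gt_atTop 0]
    with n hcn hn
  obtain ⟨hFm, G, hGF, hGc, hG⟩ := hpm n
  set G' : Set (𝒪 → ℝ) := {g | g ∈ G ∧ ∫ o, g o ^ 2 ∂P₀ ≤ c} with hG'
  have hG'c : G'.Countable := hGc.mono fun g hg => hg.1
  have hsub : {ω | ∃ g ∈ F n, ∫ o, g o ^ 2 ∂P₀ ≤ c / 2 ∧
      t * Real.sqrt n < |empDeviation P₀ O n ω g|} ⊆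
      {ω | ∃ g ∈ G', t * Real.sqrt n ≤ |empDeviation P₀ O n ω g|} := by
    rintro ω ⟨g, hg, hgc, hgt⟩
    obtain ⟨s, hsG, hs⟩ := hG g hg
    have hsF : ∀ j, s j ∈ F n := fun j => hGF (hsG j)
    have h1 : Tendsto (fun j => ∫ o, s j o ∂P₀) atTop (𝓝 (∫ o, g o ∂P₀)) :=
      tendsto_integral_of_dominated_convergence (fun _ => b)
        (fun j => (hFm _ (hsF j)).aestronglyMeasurable) (integrable_const _)
        (fun j => ae_of_all _ fun o => hb n _ (hsF j) o) (ae_of_all _ hs)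
    have h2 : Tendsto (fun j => ∫ o, s j o ^ 2 ∂P₀) atTop (𝓝 (∫ o, g o ^ 2 ∂P₀)) := by
      refine tendsto_integral_of_dominated_convergence (fun _ => b ^ 2)
        (fun j => ((hFm _ (hsF j)).pow_const 2).aestronglyMeasurable) (integrable_const _)
        (fun j => ae_of_all _ fun o => ?_) (ae_of_all _ fun o => (hs o).pow 2)
      rw [Real.norm_eq_abs, abs_pow]
      exact pow_le_pow_left₀ (abs_nonneg _) (hb n _ (hsF j) o) 2
    have h3 : Tendsto (fun j => |empDeviation P₀ O n ω (s j)|) atTop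
        (𝓝 |empDeviation P₀ O n ω g|) :=
      (tendsto_finsetSum _ fun i _ => (hs (O i ω)).sub h1).abs
    obtain ⟨j, hj1, hj2⟩ := ((h2.eventually_lt_const (show _ < c by linarith)).and
      (h3.eventually_const_lt hgt)).exists
    exact ⟨s j, ⟨hsG j, hj1.le⟩, hj2.le⟩
  refine (measure_mono hsub).trans ?_
  rcases G'.eq_empty_or_nonempty with he | hne
  · simp [he]
  obtain ⟨e, he⟩ := hG'c.exists_eq_range hne
  have hU : {ω | ∃ g ∈ G', t * Real.sqrt n ≤ |empDeviation P₀ O n ω g|} =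
      ⋃ i, {ω | t * Real.sqrt n ≤ |empDeviation P₀ O n ω (e i)|} := by
    ext ω
    simp [he]
  -- The tail bound for finite classes does not depend on their size, so it survives the increasing
  -- union.
  rw [hU, measure_iUnion_eq_iSup_accumulate]
  refine iSup_le fun N => ?_
  have heG : ∀ i, e i ∈ G' := fun i => he ▸ Set.mem_range_self i
  have hSF : ∀ g ∈ (Finset.range (N + 1)).image e, g ∈ G' := fun g hg => by
    obtain ⟨i, _, rfl⟩ := Finset.mem_image.1 hg
    exact heG i
  refine (measure_mono ?_).trans ((htail n ((Finset.range (N + 1)).image e) c t hn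
    (fun g hg => hFm _ (hGF (hSF g hg).1))
    (fun g hg o => (hb n _ (hGF (hSF g hg).1) o).trans (le_max_right _ _))
    (fun z => (hent n n hn z).hasNets hn |>.mono fun g hg => hGF (hSF g hg).1) hc hc2.2.le hcn
    (fun g hg => (hSF g hg).2) ht).trans (ENNReal.ofReal_le_ofReal ((div_le_iff₀ ht).2 hcD)))
  intro ω hω
  obtain ⟨i, hi, hωi⟩ := Set.mem_accumulate.1 hω
  exact ⟨e i, Finset.mem_image_of_mem _ (Finset.mem_range.2 (Nat.lt_succ_of_le hi)), hωi⟩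

/-- Asymptotic equicontinuity under supremum norm entropy. -/
theorem equicontinuity_of_sup_entropy (hO : ∀ i, Measurable (O i)) (hO_indep : iIndepFun O μ)
    (hO_law : ∀ i, μ.map (O i) = P₀) {K γ : ℝ} (hγ0 : 0 < γ) (hγ : γ < 2)
    {F : ℕ → Set (𝒪 → ℝ)} (hFm : ∀ n, ∀ f ∈ F n, Measurable f)
    (hent : ∀ n, EntropyBound supDist K γ (F n)) {t δ : ℝ} (ht : 0 < t) (hδ : 0 < δ) :
    ∃ c : ℝ, 0 < c ∧ ∀ᶠ n : ℕ in atTop,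
      μ {ω | ∃ g ∈ F n, MemLp g 2 P₀ ∧ ∫ o, g o ^ 2 ∂P₀ ≤ c ∧
        t * Real.sqrt n < |empDeviation P₀ O n ω g|} ≤ ENNReal.ofReal δ := by
  classical
  have hK : 0 ≤ K := (hent 0).nonneg
  obtain ⟨D, hD, htail⟩ := exists_measure_empDeviation_le (P₀ := P₀) hO hO_indep hO_law
    (show 0 ≤ 2 * K by linarith) hγ0 hγ one_le_two
  have ht3 : 0 < t / 3 := by linarith
  -- Half of `δ` pays for the tail bound on differences, the other half for Chebyshev at up to `exp
  -- K` centers. The threshold becomes `c / 4` because a difference of two functions of second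
  -- moment at most `c / 4` has second moment at most `c`.
  obtain ⟨c, ⟨⟨hcD, hc2⟩, hcK⟩, hc⟩ := ((((exists_small_rpow (p := (1 - γ / 2) / 2) (by linarith)
    (mul_pos (half_pos hδ) ht3) D).and (Ioo_mem_nhdsGT (show (0 : ℝ) < 2 by norm_num))).and
    (exists_small_rpow one_pos (half_pos hδ) (Real.exp K / (t / 3) ^ 2))).and
    self_mem_nhdsWithin).exists
  replace hc : 0 < c := hc
  rw [Real.rpow_one] at hcK
  refine ⟨c / 4, by linarith, ?_⟩
  filter_upwards [tendsto_inv_sqrt_natCast.eventually_le_const hc,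
    tendsto_inv_sqrt_natCast.eventually_le_const (show 0 < t / 3 / 4 by linarith),
    eventually_gt_atTop 0] with n hcn hnt hn
  have hn' : (0 : ℝ) < n := by exact_mod_cast hn
  have hsn : 0 < Real.sqrt n := Real.sqrt_pos.2 hn'
  have hnt' : 4 ≤ t / 3 * Real.sqrt n := by
    rw [inv_le_iff_one_le_mul₀ hsn] at hnt
    linarith
  set G : Set (𝒪 → ℝ) := {g | g ∈ F n ∧ MemLp g 2 P₀ ∧ ∫ o, g o ^ 2 ∂P₀ ≤ c / 4} with hG
  have hGF : G ⊆ F n := fun g hg => hg.1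
  -- Two scales. The class need not be bounded, so a net `A` of fixed size supplies centers that
  -- make differences bounded. The net `S` has mesh of order `1/n`; only its finiteness matters, as
  -- its size never enters.
  obtain ⟨A, hA, hAG, hAnet⟩ := (hent n).exists_internal_net hGF one_pos le_rfl
  obtain ⟨S, _, hSG, hSnet⟩ := (hent n).exists_internal_net hGF (inv_pos.2 hn')
    (inv_le_one_of_one_le₀ (by exact_mod_cast hn))
  rw [Real.one_rpow, mul_one] at hA
  set S' : Finset (𝒪 → ℝ) := ((S ×ˢ A).filter fun w => ∀ o, |w.1 o - w.2 o| ≤ 2).image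
    fun w => w.1 - w.2 with hS'
  have hS'mem : ∀ g ∈ S', ∃ s ∈ S, ∃ a ∈ A, (∀ o, |s o - a o| ≤ 2) ∧ g = s - a := by
    intro g hg
    obtain ⟨w, hw, rfl⟩ := Finset.mem_image.1 hg
    obtain ⟨hw1, hw2⟩ := Finset.mem_filter.1 hw
    exact ⟨w.1, (Finset.mem_product.1 hw1).1, w.2, (Finset.mem_product.1 hw1).2, hw2, rfl⟩
  have hsub : {ω | ∃ g ∈ F n, MemLp g 2 P₀ ∧ ∫ o, g o ^ 2 ∂P₀ ≤ c / 4 ∧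
      t * Real.sqrt n < |empDeviation P₀ O n ω g|} ⊆
      (⋃ a ∈ A, {ω | t / 3 * Real.sqrt n ≤ |empDeviation P₀ O n ω a|}) ∪
      {ω | ∃ g ∈ S', t / 3 * Real.sqrt n ≤ |empDeviation P₀ O n ω g|} := by
    rintro ω ⟨g, hgF, hg2, hgc, hgt⟩
    have hgG : g ∈ G := ⟨hgF, hg2, hgc⟩
    obtain ⟨s, hs, hgs⟩ := hSnet g hgG
    obtain ⟨a, ha, hsa⟩ := hAnet s (hSG s hs)
    rw [mul_one] at hsa
    have hgi := hg2.integrable one_le_two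
    have hsi := (hSG s hs).2.1.integrable one_le_two
    have hai := (hAG a ha).2.1.integrable one_le_two
    -- Three pieces: `g - s` is negligible for every sample, `a` is one of boundedly many centers,
    -- and `s - a` lies in the bounded finite class.
    have h1 : g = (g - s) + (a + (s - a)) := by
      rw [add_sub_cancel, sub_add_cancel]
    have h2 : empDeviation P₀ O n ω g = empDeviation P₀ O n ω (g - s) +
        (empDeviation P₀ O n ω a + empDeviation P₀ O n ω (s - a)) := by
      conv_lhs => rw [h1]
      rw [empDeviation_add (hgi.sub hsi) (hai.add (hsi.sub hai)),
        empDeviation_add hai (hsi.sub hai)]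
    -- `n · 2 · (2/n) = 4`, which is at most `(t/3) √n` for large `n`.
    have h3 : |empDeviation P₀ O n ω (g - s)| ≤ 4 := by
      refine (abs_empDeviation_le (g := g - s) hgs n ω).trans (le_of_eq ?_)
      field_simp
      norm_num
    by_cases h4 : t / 3 * Real.sqrt n ≤ |empDeviation P₀ O n ω a|
    · exact Or.inl (Set.mem_biUnion ha h4)
    · refine Or.inr ⟨s - a, Finset.mem_image.2 ⟨(s, a), Finset.mem_filter.2
        ⟨Finset.mk_mem_product hs ha, hsa⟩, rfl⟩, ?_⟩
      rw [h2] at hgt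
      have h5 := abs_add_le (empDeviation P₀ O n ω (g - s))
        (empDeviation P₀ O n ω a + empDeviation P₀ O n ω (s - a))
      have h6 := abs_add_le (empDeviation P₀ O n ω a) (empDeviation P₀ O n ω (s - a))
      linarith
  have hcenters : μ (⋃ a ∈ A, {ω | t / 3 * Real.sqrt n ≤ |empDeviation P₀ O n ω a|}) ≤
      ENNReal.ofReal (δ / 2) := by
    refine (measure_biUnion_finset_le _ _).trans ?_
    refine (Finset.sum_le_sum fun a ha => measure_empDeviation_ge_le hO hO_indep hO_law hn
      (hFm n _ (hAG a ha).1) (hAG a ha).2.1 (c := c)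
      ((hAG a ha).2.2.trans (by linarith)) ht3).trans ?_
    rw [Finset.sum_const, nsmul_eq_mul, ← ENNReal.ofReal_natCast, ← ENNReal.ofReal_mul
      (Nat.cast_nonneg _)]
    refine ENNReal.ofReal_le_ofReal (le_trans ?_ hcK)
    rw [div_mul_eq_mul_div, mul_div_assoc']
    gcongr
  have hdiff := htail n S' c (t / 3) hn
    (fun g hg => by
      obtain ⟨s, hs, a, ha, _, rfl⟩ := hS'mem g hg
      exact (hFm n _ (hSG s hs).1).sub (hFm n _ (hAG a ha).1))
    (fun g hg => by
      obtain ⟨s, hs, a, ha, hsa, rfl⟩ := hS'mem g hg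
      exact hsa)
    -- Differences are covered by pairs of a net point and a center; the extra `K` is at most `K
    -- ε^{-γ}`, whence the constant `2K`.
    (fun z ε hε hε1 => by
      obtain ⟨T, hT, hTF⟩ := (hent n).exists_net hε hε1
      refine ⟨(T ×ˢ A).image fun w => w.1 - w.2, card_image_le_exp _ ?_, fun g hg => ?_⟩
      · rw [Finset.card_product, Nat.cast_mul]
        refine (mul_le_mul hT hA (Nat.cast_nonneg _) (Real.exp_pos _).le).trans ?_
        rw [← Real.exp_add, Real.exp_le_exp]
        have h1 : 1 ≤ ε ^ (-γ) :=
          Real.one_le_rpow_of_pos_of_le_one_of_nonpos hε hε1 (by linarith)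
        nlinarith
      · obtain ⟨s, hs, a, ha, _, rfl⟩ := hS'mem g hg
        obtain ⟨h, hh, hsh⟩ := hTF s (hSG s hs).1
        refine ⟨h - a, Finset.mem_image.2 ⟨(h, a), Finset.mk_mem_product hh ha, rfl⟩, ?_⟩
        have h1 : ∀ i ∈ Finset.univ, ((s - a) (z i) - (h - a) (z i)) ^ 2 ≤ ε ^ 2 := fun i _ => by
          have h2 := (supDist_le_iff hε.le).1 hsh (z i)
          simp only [Pi.sub_apply, sub_sub_sub_cancel_right]
          exact sq_le_sq' (by linarith [(abs_le.1 h2).1]) (abs_le.1 h2).2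
        refine (Finset.sum_le_sum h1).trans ?_
        simp)
    hc hc2.2.le hcn
    (fun g hg => by
      obtain ⟨s, hs, a, ha, _, rfl⟩ := hS'mem g hg
      have h1 := (hSG s hs).2
      have h2 := (hAG a ha).2
      have h3 : ∫ o, (s - a) o ^ 2 ∂P₀ ≤ ∫ o, (2 * s o ^ 2 + 2 * a o ^ 2) ∂P₀ := by
        refine integral_mono (h1.1.sub h2.1).integrable_sq
          ((h1.1.integrable_sq.const_mul 2).add (h2.1.integrable_sq.const_mul 2)) fun o => ?_
        simp only [Pi.sub_apply]
        nlinarith [sq_nonneg (s o + a o)]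
      rw [integral_add (h1.1.integrable_sq.const_mul 2) (h2.1.integrable_sq.const_mul 2),
        integral_const_mul, integral_const_mul] at h3
      linarith [h1.2, h2.2]) ht3
  have hdiff' := hdiff.trans (ENNReal.ofReal_le_ofReal ((div_le_iff₀ ht3).2 hcD))
  refine (measure_mono hsub).trans ((measure_union_le _ _).trans
    ((add_le_add hcenters hdiff').trans ?_))
  rw [← ENNReal.ofReal_add (by linarith) (by linarith), add_halves]

/-- Asymptotic equicontinuity under the entropy condition. -/
theorem EntropyCondition.equicontinuity [IsProbabilityMeasure μ] (hO : ∀ i, Measurable (O i)) (hO_indep : iIndepFun O μ)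
    (hO_law : ∀ i, μ.map (O i) = P₀) {F : ℕ → Set (𝒪 → ℝ)}
    (hFm : ∀ n, ∀ f ∈ F n, Measurable f) (hF : EntropyCondition F) {t δ : ℝ} (ht : 0 < t)
    (hδ : 0 < δ) :
    ∃ c : ℝ, 0 < c ∧ ∀ᶠ n : ℕ in atTop,
      μ {ω | ∃ g ∈ F n, MemLp g 2 P₀ ∧ ∫ o, g o ^ 2 ∂P₀ ≤ c ∧
        t * Real.sqrt n < |empDeviation P₀ O n ω g|} ≤ ENNReal.ofReal δ := by
  obtain ⟨K, γ, hγ0, hγ, h | ⟨b, F', h⟩⟩ := hF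
  · exact equicontinuity_of_sup_entropy hO hO_indep hO_law hγ0 hγ hFm h ht hδ
  · obtain ⟨c, hc, hev⟩ := equicontinuity_of_uniform_entropy hO hO_indep hO_law hγ0 hγ
      (fun n => (h n).2.1) (fun n => (h n).2.2.1) (fun n => (h n).2.2.2) ht hδ
    refine ⟨c, hc, hev.mono fun n hn => (measure_mono ?_).trans hn⟩
    rintro ω ⟨g, hg, _, hgc, hgt⟩
    exact ⟨g, (h n).1 hg, hgc, hgt⟩

end Equicontinuity

/-! ## Asymptotic negligibility of the empirical score -/

section Negligibility

variable {𝒪 Ω : Type*} [MeasurableSpace 𝒪]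
  {P₀ : Measure 𝒪} {O : ℕ → Ω → 𝒪} {d k : ℕ}

theorem integral_sq_le_of_eLpNorm_le {g : 𝒪 → ℝ} {c : ℝ} (hg : Measurable g) (hc : 0 ≤ c)
    (h : eLpNorm g 2 P₀ ≤ ENNReal.ofReal (Real.sqrt c)) :
    MemLp g 2 P₀ ∧ ∫ o, g o ^ 2 ∂P₀ ≤ c := by
  have hm : MemLp g 2 P₀ := ⟨hg.aestronglyMeasurable, h.trans_lt ENNReal.ofReal_lt_top⟩
  refine ⟨hm, ?_⟩
  rw [hm.eLpNorm_eq_integral_rpow_norm two_ne_zero ENNReal.ofNat_ne_top,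
    ENNReal.ofReal_le_ofReal_iff (Real.sqrt_nonneg _)] at h
  simp only [ENNReal.toReal_ofNat, Real.rpow_ofNat, Real.norm_eq_abs, sq_abs] at h
  rw [← one_div, ← Real.sqrt_eq_rpow] at h
  exact (Real.sqrt_le_sqrt_iff hc).1 h

theorem empMean_eq [IsProbabilityMeasure P₀] {n : ℕ} (hn : 0 < n) (ω : Ω) (g : 𝒪 → ℝ) :
    empMean O n ω g = empDeviation P₀ O n ω g / n + ∫ o, g o ∂P₀ := by
  have hn' : (n : ℝ) ≠ 0 := by exact_mod_cast hn.ne'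
  rw [empMean, empDeviation, Finset.sum_sub_distrib]
  simp only [Finset.sum_const, Finset.card_range, nsmul_eq_mul]
  field_simp
  ring

theorem measurable_of_mem_scoreClass {L : (Cube d → ℝ) → 𝒪 → ℝ}
    (hL : HasLinearScore L (splineSpace d k)) {M : ℝ} {B : ℕ → Ω → PCModel d k}
    {α : ∀ n ω, Fin (B n ω).q → ℝ} {n : ℕ} {g : 𝒪 → ℝ} (hg : g ∈ scoreClass L M B α n) :
    Measurable g := by
  obtain ⟨ω, θ, _, f, _, rfl⟩ := hg
  exact hL.measurable _ (PCModel.theta_mem _ _) _ (PCModel.theta_mem _ _)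

variable [MeasurableSpace Ω] {μ : Measure Ω}

/-- Linear scores in random directions are of order `o_P(n^{-1/2})`, when the directions are small
in `L²(P₀)` and the second order remainder is negligible. -/
theorem isLittleOP_empMean_score [IsProbabilityMeasure μ] [IsProbabilityMeasure P₀]
    (hO : ∀ i, Measurable (O i)) (hO_indep : iIndepFun O μ) (hO_law : ∀ i, μ.map (O i) = P₀)
    {L : (Cube d → ℝ) → 𝒪 → ℝ} {ψ₀ : Cube d → ℝ} (hψ₀ : IsRiskMinimizer P₀ L ψ₀)
    (hL : HasLinearScore L (splineSpace d k)) (hL₀ : HasScoreAt P₀ L ψ₀ (splineSpace d k))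
    {B : ℕ → Ω → PCModel d k} {α f : ∀ n ω, Fin (B n ω).q → ℝ} {M : ℝ}
    (hent : EntropyCondition (scoreClass L M B α))
    (hmem : Tendsto (fun n => μ {ω | ¬ (α n ω ∈ (B n ω).ballM M (α n ω) ∧
        f n ω ∈ (B n ω).ballM M (α n ω))}) atTop (𝓝 0))
    (hsmall : IsLittleOP μ (fun n ω => eLpNorm (score L ((B n ω).theta (α n ω))
        ((B n ω).theta (f n ω))) 2 P₀) fun _ => 1)
    {K : NNReal} {Y : ℕ → Ω → ℝ≥0∞}
    (hK : ∀ n ω, α n ω ∈ (B n ω).ballM M (α n ω) → f n ω ∈ (B n ω).ballM M (α n ω) →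
      ENNReal.ofReal |∫ o, (score L ((B n ω).theta (α n ω)) ((B n ω).theta (f n ω)) o
        - score L ψ₀ ((B n ω).theta (f n ω)) o) ∂P₀| ≤ K * Y n ω)
    (hY : IsLittleOP μ Y fun n => (n : ℝ) ^ (-(1 / 2) : ℝ)) :
    IsLittleOP μ (fun n ω => ENNReal.ofReal
        |empMean O n ω (score L ((B n ω).theta (α n ω)) ((B n ω).theta (f n ω)))|)
      fun n => (n : ℝ) ^ (-(1 / 2) : ℝ) := by
  intro ε hε
  rw [ENNReal.tendsto_nhds_zero]
  intro δ hδ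
  obtain ⟨δ', hδ'0, hδ'⟩ : ∃ δ' : ℝ, 0 < δ' ∧ ENNReal.ofReal δ' ≤ δ := by
    rcases eq_or_ne δ ⊤ with rfl | hδt
    · exact ⟨1, one_pos, le_top⟩
    · exact ⟨δ.toReal, ENNReal.toReal_pos hδ.ne' hδt, (ENNReal.ofReal_toReal hδt).le⟩
  have hδ4 : 0 < ENNReal.ofReal (δ' / 4) := ENNReal.ofReal_pos.2 (by linarith)
  obtain ⟨c, hc, hequi⟩ := hent.equicontinuity hO hO_indep hO_law
    (fun n g hg => measurable_of_mem_scoreClass hL hg) (half_pos hε)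
    (show 0 < δ' / 4 by linarith)
  have hK1 : (0 : ℝ) < K + 1 := by positivity
  -- Four exceptional events of measure at most `δ'/4` each; off their union the bound is pathwise.
  -- Dividing by `K + 1` avoids the case `K = 0`.
  filter_upwards [ENNReal.tendsto_nhds_zero.1 hmem _ hδ4,
    ENNReal.tendsto_nhds_zero.1 (hsmall _ (Real.sqrt_pos.2 hc)) _ hδ4,
    ENNReal.tendsto_nhds_zero.1 (hY (ε / 2 / (K + 1)) (by positivity)) _ hδ4, hequi,
    eventually_gt_atTop 0] with n h1 h2 h3 h4 hn
  have hn' : (0 : ℝ) < n := by exact_mod_cast hn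
  have hsum : ENNReal.ofReal (δ' / 4) + ENNReal.ofReal (δ' / 4) +
      (ENNReal.ofReal (δ' / 4) + ENNReal.ofReal (δ' / 4)) ≤ δ := by
    rw [← ENNReal.ofReal_add (by linarith) (by linarith),
      ← ENNReal.ofReal_add (by linarith) (by linarith)]
    exact (ENNReal.ofReal_le_ofReal (by linarith)).trans hδ'
  refine le_trans ?_ hsum
  refine le_trans (measure_mono ?_) ((measure_union_le _ _).trans (add_le_add
    ((measure_union_le _ _).trans (add_le_add h1 h2))
    ((measure_union_le _ _).trans (add_le_add h3 h4))))
  intro ω hω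
  by_contra hnot
  simp only [Set.mem_union, not_or] at hnot
  obtain ⟨⟨hmem', hg2'⟩, hYω', hdev''⟩ := hnot
  obtain ⟨hα, hf⟩ : α n ω ∈ (B n ω).ballM M (α n ω) ∧ f n ω ∈ (B n ω).ballM M (α n ω) :=
    not_not.1 hmem'
  have hg2 : eLpNorm (score L ((B n ω).theta (α n ω)) ((B n ω).theta (f n ω))) 2 P₀ ≤
      ENNReal.ofReal (Real.sqrt c * 1) := not_lt.1 hg2'
  have hYω : Y n ω ≤ ENNReal.ofReal (ε / 2 / (K + 1) * (n : ℝ) ^ (-(1 / 2) : ℝ)) :=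
    not_lt.1 hYω'
  rw [mul_one] at hg2
  set g := score L ((B n ω).theta (α n ω)) ((B n ω).theta (f n ω)) with hg
  have hgF : g ∈ scoreClass L M B α n := ⟨ω, _, hα, _, hf, rfl⟩
  obtain ⟨hgm, hgc⟩ := integral_sq_le_of_eLpNorm_le (measurable_of_mem_scoreClass hL hgF) hc.le hg2
  -- The class collects the scores of all outcomes, so the realized score is one of the competitors
  -- in the uniform bound.
  have hdev' : |empDeviation P₀ O n ω g| ≤ ε / 2 * Real.sqrt n :=
    not_lt.1 fun h => hdev'' ⟨g, hgF, hgm, hgc, h⟩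
  have hr : (0 : ℝ) ≤ (n : ℝ) ^ (-(1 / 2) : ℝ) := Real.rpow_nonneg hn'.le _
  -- The population score at `ψ₀` vanishes, so the mean of `g` is exactly the second order
  -- remainder.
  have hmean : |∫ o, g o ∂P₀| ≤ ε / 2 * (n : ℝ) ^ (-(1 / 2) : ℝ) := by
    have h5 := hK n ω hα hf
    rw [integral_sub (hgm.integrable one_le_two) (hL₀.integrable_score _ (PCModel.theta_mem _ _)),
      integral_score_riskMinimizer hψ₀ hL₀ (PCModel.theta_mem _ _), sub_zero] at h5
    have h6 := h5.trans (mul_le_mul' le_rfl hYω)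
    rw [← ENNReal.ofReal_coe_nnreal, ← ENNReal.ofReal_mul K.coe_nonneg,
      ENNReal.ofReal_le_ofReal_iff (by positivity)] at h6
    refine h6.trans ?_
    rw [← mul_assoc]
    refine mul_le_mul_of_nonneg_right ?_ hr
    rw [mul_div_assoc', div_le_iff₀ hK1]
    nlinarith [K.coe_nonneg]
  have hdiv : |empDeviation P₀ O n ω g / n| ≤ ε / 2 * (n : ℝ) ^ (-(1 / 2) : ℝ) := by
    rw [abs_div, abs_of_pos hn', div_le_iff₀ hn']
    refine hdev'.trans (le_of_eq ?_)
    rw [mul_assoc, ← Real.rpow_add_one hn'.ne', Real.sqrt_eq_rpow]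
    norm_num
  have habs : |empMean O n ω g| ≤ ε * (n : ℝ) ^ (-(1 / 2) : ℝ) := by
    rw [empMean_eq (P₀ := P₀) hn]
    refine (abs_add_le _ _).trans ((add_le_add hdiv hmean).trans (le_of_eq ?_))
    ring
  exact absurd hω (not_lt.2 (ENNReal.ofReal_le_ofReal habs))

theorem IsLittleOP.mono {X Y : ℕ → Ω → ℝ≥0∞} {r : ℕ → ℝ} (hY : IsLittleOP μ Y r)
    (h : ∀ n ω, X n ω ≤ Y n ω) : IsLittleOP μ X r := fun ε hε =>
  tendsto_of_tendsto_of_tendsto_of_le_of_le tendsto_const_nhds (hY ε hε)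
    (fun _ => zero_le) fun n => measure_mono fun ω hω => lt_of_lt_of_le hω (h n ω)

end Negligibility

/-! ### Score equations, projection error and negligibility combined. -/

theorem mainTheorem8 {d k : ℕ} {𝒪 Ω : Type*} [MeasurableSpace 𝒪] [MeasurableSpace Ω]
    (μ : Measure Ω) [IsProbabilityMeasure μ] (P₀ : Measure 𝒪) [IsProbabilityMeasure P₀]
    -- i.i.d. observations from `P₀`, with the point `X o` of the cube belonging to `o`
    (O : ℕ → Ω → 𝒪) (hO : ∀ i, Measurable (O i)) (hO_indep : iIndepFun O μ)
    (hO_law : ∀ i, μ.map (O i) = P₀)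
    (X : 𝒪 → Cube d) (hX : Measurable X)
    -- the loss and the target function
    (L : (Cube d → ℝ) → 𝒪 → ℝ) (ψ₀ : Cube d → ℝ)
    (hψ₀ : IsRiskMinimizer P₀ L ψ₀)
    (hL : HasLinearScore L (splineSpace d k))
    (hL₀ : HasScoreAt P₀ L ψ₀ (splineSpace d k))
    -- the PC working models, the radii, the PC-HAR estimators and the projections
    (B : ℕ → Ω → PCModel d k) (C : ℕ → Ω → ℝ) (hC : ∀ n ω, 0 < C n ω)
    (α : ∀ n ω, Fin (B n ω).q → ℝ)
    (hα : ∀ n ω, IsPCHAR L O n ω (B n ω) (C n ω) (α n ω))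
    (t : ∀ n ω, Fin (B n ω).q → ℝ)
    (ht : ∀ n ω, IsL2Projection P₀ X (B n ω) (α n ω) (t n ω)) :
    -- the estimator minimises the empirical risk over the ball in the active submodel
    (∀ n ω (b : Fin (B n ω).q → ℝ), ActiveIn (α n ω) b → norm2 b ≤ C n ω →
      empMean O n ω (L ((B n ω).theta (α n ω))) ≤ empMean O n ω (L ((B n ω).theta b))) ∧
    -- it solves the score equations in all directions orthogonal to `α_n`
    (∀ n ω (h : Fin (B n ω).q → ℝ), ip h (α n ω) = 0 →
      empMean O n ω (score L ((B n ω).theta (α n ω)) ((B n ω).theta h)) = 0) ∧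
    -- the score equation in a general direction of the active submodel
    (∀ n ω (f : Fin (B n ω).q → ℝ), ActiveIn (α n ω) f →
      empMean O n ω (score L ((B n ω).theta (α n ω)) ((B n ω).theta f)) =
        Real.sqrt (activeCard (α n ω)) * ip f (unitDir (α n ω)) *
          empMean O n ω (score L ((B n ω).theta (α n ω))
            ((B n ω).theta (starDir (α n ω) - t n ω)))) ∧
    (∀ n ω, empMean O n ω (score L ((B n ω).theta (α n ω)) ((B n ω).theta (starDir (α n ω)))) =
      empMean O n ω (score L ((B n ω).theta (α n ω))
        ((B n ω).theta (starDir (α n ω) - t n ω)))) ∧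
    -- conservative bounds for the projection error
    (∀ n ω (i : Fin (B n ω).q), α n ω i ≠ 0 →
      eLpNorm (fun o => (B n ω).theta (starDir (α n ω) - t n ω) (X o)) 1 P₀
          ≤ eLpNorm (fun o => (B n ω).theta (starDir (α n ω) - t n ω) (X o)) 2 P₀ ∧
      eLpNorm (fun o => (B n ω).theta (starDir (α n ω) - t n ω) (X o)) 2 P₀
          ≤ ENNReal.ofReal (cConst (α n ω) i) * eLpNorm (fun o => (B n ω).pc i (X o)) 2 P₀ ∧
      (∃ h ∈ tangentDirs (α n ω),
        eLpNorm (fun o => (B n ω).theta (starDir (α n ω) - h) (X o)) 1 P₀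
          ≤ ENNReal.ofReal (cConst (α n ω) i) * eLpNorm (fun o => (B n ω).pc i (X o)) 1 P₀) ∧
      norm2 (α n ω) ^ 2 / |α n ω i|
        = Real.sqrt (activeCard (α n ω)) * norm2 (α n ω) * cConst (α n ω) i) ∧
    -- asymptotic negligibility of the empirical score
    (∀ M : ℝ,
      -- complexity of the score class
      EntropyCondition (scoreClass L M B α) →
      -- with probability tending to one, `θ_n` and `f_{α_n}^* - f̃_{α_n}` are in `D_M(𝓔(J_n))`
      Tendsto (fun n => μ {ω | ¬ (α n ω ∈ (B n ω).ballM M (α n ω) ∧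
        starDir (α n ω) - t n ω ∈ (B n ω).ballM M (α n ω))}) atTop (𝓝 0) →
      -- the score in the direction `f_{α_n}^* - f̃_{α_n}` tends to zero in `L²(P₀)`
      IsLittleOP μ (fun n ω => eLpNorm (score L ((B n ω).theta (α n ω))
        ((B n ω).theta (starDir (α n ω) - t n ω))) 2 P₀) (fun _ => 1) →
      -- second order bound for the mean score, and the projection approximation condition
      ((∃ K : NNReal, ∀ n ω, ∀ θ ∈ (B n ω).ballM M (α n ω), ∀ f ∈ (B n ω).ballM M (α n ω),
            ENNReal.ofReal |∫ o, (score L ((B n ω).theta θ) ((B n ω).theta f) o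
                - score L ψ₀ ((B n ω).theta f) o) ∂P₀|
              ≤ K * supDist ((B n ω).theta θ) ψ₀
                  * eLpNorm (fun o => (B n ω).theta f (X o)) 1 P₀) ∧
          IsLittleOP μ (fun n ω => supDist ((B n ω).theta (α n ω)) ψ₀
            * eLpNorm (fun o => (B n ω).theta (starDir (α n ω) - t n ω) (X o)) 1 P₀)
            (fun n => (n : ℝ) ^ (-(1 / 2) : ℝ)) ∨
        (∃ K : NNReal, ∀ n ω, ∀ θ ∈ (B n ω).ballM M (α n ω), ∀ f ∈ (B n ω).ballM M (α n ω),
            ENNReal.ofReal |∫ o, (score L ((B n ω).theta θ) ((B n ω).theta f) o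
                - score L ψ₀ ((B n ω).theta f) o) ∂P₀|
              ≤ K * ENNReal.ofReal (Real.sqrt
                    (∫ o, L ((B n ω).theta θ) o ∂P₀ - ∫ o, L ψ₀ o ∂P₀))
                  * eLpNorm (fun o => (B n ω).theta f (X o)) 2 P₀) ∧
          IsLittleOP μ (fun n ω => ENNReal.ofReal (Real.sqrt
              (∫ o, L ((B n ω).theta (α n ω)) o ∂P₀ - ∫ o, L ψ₀ o ∂P₀))
            * eLpNorm (fun o => (B n ω).theta (starDir (α n ω) - t n ω) (X o)) 2 P₀)
            (fun n => (n : ℝ) ^ (-(1 / 2) : ℝ))) →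
      IsLittleOP μ (fun n ω => ⨆ f ∈ {f | f ∈ (B n ω).ballM M (α n ω) ∧
            norm2 f ≤ (Real.sqrt (activeCard (α n ω)))⁻¹},
          ENNReal.ofReal |empMean O n ω (score L ((B n ω).theta (α n ω)) ((B n ω).theta f))|)
        (fun n => (n : ℝ) ^ (-(1 / 2) : ℝ))) := by
  refine ⟨fun n ω b _ hb => (hα n ω).2 b hb,
    fun n ω h hh => (hα n ω).empMean_score_eq_zero hL (hC n ω) hh,
    fun n ω f hf => (hα n ω).empMean_score_eq hL (hC n ω) (ht n ω).1 hf,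
    fun n ω => (hα n ω).empMean_score_starDir hL (hC n ω) (ht n ω).1, ?_, ?_⟩
  · intro n ω i hi
    -- The same competitor serves both norms: the projection beats it in `L²`, and it is itself the
    -- witness in `L¹`.
    obtain ⟨h, hh, c, hc, hch⟩ := exists_mem_tangentDirs hi
    refine ⟨eLpNorm_le_eLpNorm_of_exponent_le one_le_two
      (memLp_theta hX _ 1).aestronglyMeasurable, ?_, ⟨h, hh, ?_⟩, ?_⟩
    · refine ((ht n ω).eLpNorm_le hX hh).trans (le_of_eq ?_)
      rw [hch, eLpNorm_theta_smul_single, hc]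
    · rw [hch, eLpNorm_theta_smul_single, hc]
    · have hJ : Real.sqrt (activeCard (α n ω)) ≠ 0 :=
        (Real.sqrt_pos.2 (by exact_mod_cast activeCard_pos hi)).ne'
      rw [cConst]
      field_simp
  · intro M hent hmem hsmall hrem
    -- For each outcome the supremum is dominated by the score in the one direction `f_a^* - t`, so
    -- no uniformity over `f` remains to be shown.
    refine IsLittleOP.mono (Y := fun n ω => ENNReal.ofReal |empMean O n ω
      (score L ((B n ω).theta (α n ω)) ((B n ω).theta (starDir (α n ω) - t n ω)))|) ?_ ?_
    · rcases hrem with ⟨⟨K, hK⟩, hY⟩ | ⟨⟨K, hK⟩, hY⟩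
      · refine isLittleOP_empMean_score hO hO_indep hO_law hψ₀ hL hL₀ hent hmem hsmall
          (K := K) (fun n ω hα hf => ?_) hY
        rw [← mul_assoc]
        exact hK n ω _ hα _ hf
      · refine isLittleOP_empMean_score hO hO_indep hO_law hψ₀ hL hL₀ hent hmem hsmall
          (K := K) (fun n ω hα hf => ?_) hY
        rw [← mul_assoc]
        exact hK n ω _ hα _ hf
    · intro n ω
      refine iSup₂_le fun f hf => ENNReal.ofReal_le_ofReal ?_
      exact (hα n ω).abs_empMean_score_le hL (hC n ω) (ht n ω).1 hf.1.1 hf.2
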